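/- Let $N,m\ge 1$ be integers and let $M=\mathbb T^N=\mathbb R^N/\mathbb Z^N$ be the flat torus, with the distance $|x-y|$ induced by the Euclidean distance of $\mathbb R^N$; let $\|v\|=\max_i|v_i|$ on $\mathbb R^m$. For $1\le i\le m$ let $H_i:M\times\mathbb R^N\times\mathbb R^m\to\mathbb R$, $(x,p,\mathbf u)\mapsto H_i(x,p,\mathbf u)$, satisfy: (H1) $H_i$ is of class $C^2$; (H2) $p\mapsto H_i(x,p,\mathbf u)$ is strictly convex for every $(x,\mathbf u)$; (H3) $H_i(x,p,\mathbf u)/|p|\to\infty$ as $|p|\to\infty$, for every $(x,\mathbf u)$; (H4) there is $\Theta_i>0$ with $|H_i(x,p,\mathbf u)-H_i(x,p,\mathbf v)|\le\Theta_i\|\mathbf u-\mathbf v\|$ for all $x,p,\mathbf u,\mathbf v$; (A) $H_i(x,p,\mathbf u)=h_i(x,p)+P_i(x,\mathbf u)$, and there are $0<a<1<A$, independent of $i$, such that $a|p|^2\le h_i(x,p)\le A|p|^2$ and $|\partial_xh_i(x,p)|\le A|p|^2$ for all $i,x,p$. Let $\varphi:M\to\mathbb R^m$ be continuous, and let $\mathbf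 u:M\times[0,\infty)\to\mathbb R^m$ be a (the unique) viscosity solution of the Cauchy problem $$\partial_tu_i+H_i(x,\partial_xu_i,\mathbf u)=0\ \text{ on } M\times(0,\infty),\qquad \mathbf u(\cdot,0)=\varphi,\qquad 1\le i\le m,$$ that is, $\mathbf u$ is continuous, $\mathbf u(\cdot,0)=\varphi$, and for every $i$, every $(x,t)$ with $t>0$ and every real function $\phi$ of class $C^1$ near $(x,t)$: if $u_i-\phi$ has a local maximum at $(x,t)$, then $\partial_t\phi(x,t)+H_i(x,\partial_x\phi(x,t),\mathbf u(x,t))\le0$; if $u_i-\phi$ has a local minimum at $(x,t)$, then $\partial_t\phi(x,t)+H_i(x,\partial_x\phi(x,t),\mathbf u(x,t))\ge0$. Then $\mathbf u$ is locally Lipschitz on $M\times(0,\infty)$: for every $(x_0,t_0)\in M\times(0,\infty)$ there are $r,\kappa>0$ such that $\|\mathbf u(x,t)-\mathbf u(y,s)\|\le\kappa(|x-y|+|t-s|)$ for all $(x,t),(y,s)\in M\times(0,\infty)$ with $|x-x_0|+|t-t_0|<r$ and $|y-x_0|+|s-t_0|<r$. -/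

import Mathlib

namespace WeaklyCoupledHJ

/-- Euclidean space `ℝ^N` with the Euclidean norm. -/
abbrev Euc (N : ℕ) : Type := EuclideanSpace ℝ (Fin N)

/-- The subgroup `ℤ^N` of `ℝ^N`. -/
def integerLattice (N : ℕ) : AddSubgroup (Euc N) where
  carrier := {v | ∀ j, ∃ k : ℤ, v j = k}
  zero_mem' := fun _ => ⟨0, by simp⟩
  add_mem' := by
    intro v w hv hw j
    obtain ⟨k, hk⟩ := hv j
    obtain ⟨l, hl⟩ := hw j
    exact ⟨k + l, by simp [hk, hl]⟩
  neg_mem' := by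
    intro v hv j
    obtain ⟨k, hk⟩ := hv j
    exact ⟨-k, by simp [hk]⟩

/-- The flat torus `𝕋^N = ℝ^N / ℤ^N`. Its topology is the quotient topology and its distance is
the one induced by the quotient of the Euclidean norm: `dist [v] [w] = inf_{k ∈ ℤ^N} |v - w + k|`.
Tangent and cotangent spaces are identified with `ℝ^N`. -/
abbrev Torus (N : ℕ) : Type := Euc N ⧸ integerLattice N

/-- The projection `ℝ^N → 𝕋^N`. Being a local isometry it serves as a chart around every point:
smoothness and derivatives in the space variable are computed after composing with it. -/
def proj {N : ℕ} (y : Euc N) : Torus N := QuotientAddGroup.mk y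

/-- A system of Hamiltonians `H_i(x, p, u)`, `x ∈ 𝕋^N`, `p ∈ ℝ^N`, `u ∈ ℝ^m`
(`Fin m → ℝ` carries the maximum norm). -/
abbrev Hamiltonians (N m : ℕ) : Type := Fin m → Torus N → Euc N → (Fin m → ℝ) → ℝ

/-- The standing assumptions on the Hamiltonians. -/
structure StandingAssumptions {N m : ℕ} (H : Hamiltonians N m) : Prop where
  /-- `H_i` is of class `C²` in `(x, p, u)`. -/
  contDiff : ∀ i, ContDiff ℝ 2
    (fun z : Euc N × Euc N × (Fin m → ℝ) => H i (proj z.1) z.2.1 z.2.2)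
  /-- `H_i` is strictly convex in `p`. -/
  strictConvex : ∀ i x u, StrictConvexOn ℝ Set.univ (fun p => H i x p u)
  /-- `H_i` is superlinear in `p`. -/
  superlinear : ∀ i x u,
    Filter.Tendsto (fun p => H i x p u / ‖p‖) (Bornology.cobounded (Euc N)) Filter.atTop
  /-- `H_i` is Lipschitz in `u`, uniformly in `(x, p)`. -/
  lipschitz : ∀ i, ∃ Θ : ℝ, 0 < Θ ∧ ∀ x p u v, |H i x p u - H i x p v| ≤ Θ * ‖u - v‖

/-- The model structure `H_i(x, p, u) = h_i(x, p) + P_i(x, u)` with `h_i` of quadratic growth. -/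
def ModelStructure {N m : ℕ} (H : Hamiltonians N m) : Prop :=
  ∃ (h : Fin m → Torus N → Euc N → ℝ) (P : Fin m → Torus N → (Fin m → ℝ) → ℝ) (a A : ℝ),
    0 < a ∧ a < 1 ∧ 1 < A ∧
    (∀ i x p u, H i x p u = h i x p + P i x u) ∧
    (∀ i x p, a * ‖p‖ ^ 2 ≤ h i x p ∧ h i x p ≤ A * ‖p‖ ^ 2) ∧
    (∀ i (y p : Euc N), ‖gradient (fun z => h i (proj z) p) y‖ ≤ A * ‖p‖ ^ 2)

/-- Viscosity subsolution of `∂_t u_i + H_i(x, ∂_x u_i, u) = 0`, `u(·, 0) = φ`. Only the values of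
`u` at times `t ≥ 0` matter. The test function `f` is given in the chart `proj`;
`ContDiffAt ℝ 1` says that it is `C¹` on a neighbourhood of the point. -/
structure IsViscositySubsolution {N m : ℕ} (H : Hamiltonians N m) (φ : Torus N → Fin m → ℝ)
    (u : Torus N → ℝ → Fin m → ℝ) : Prop where
  continuousOn : ContinuousOn (fun z : Torus N × ℝ => u z.1 z.2) (Set.univ ×ˢ Set.Ici 0)
  initial : ∀ i x, u x 0 i ≤ φ x i
  sub : ∀ i (y : Euc N) (t : ℝ), 0 < t → ∀ f : Euc N × ℝ → ℝ, ContDiffAt ℝ 1 f (y, t) →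
    IsLocalMax (fun z : Euc N × ℝ => u (proj z.1) z.2 i - f z) (y, t) →
    deriv (fun s => f (y, s)) t
      + H i (proj y) (gradient (fun z => f (z, t)) y) (u (proj y) t) ≤ 0

/-- Viscosity supersolution of `∂_t u_i + H_i(x, ∂_x u_i, u) = 0`, `u(·, 0) = φ`. -/
structure IsViscositySupersolution {N m : ℕ} (H : Hamiltonians N m) (φ : Torus N → Fin m → ℝ)
    (u : Torus N → ℝ → Fin m → ℝ) : Prop where
  continuousOn : ContinuousOn (fun z : Torus N × ℝ => u z.1 z.2) (Set.univ ×ˢ Set.Ici 0)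
  initial : ∀ i x, φ x i ≤ u x 0 i
  super : ∀ i (y : Euc N) (t : ℝ), 0 < t → ∀ f : Euc N × ℝ → ℝ, ContDiffAt ℝ 1 f (y, t) →
    IsLocalMin (fun z : Euc N × ℝ => u (proj z.1) z.2 i - f z) (y, t) →
    0 ≤ deriv (fun s => f (y, s)) t
      + H i (proj y) (gradient (fun z => f (z, t)) y) (u (proj y) t)

/-- Viscosity solution of the Cauchy problem. -/
def IsViscositySolution {N m : ℕ} (H : Hamiltonians N m) (φ : Torus N → Fin m → ℝ)
    (u : Torus N → ℝ → Fin m → ℝ) : Prop :=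
  IsViscositySubsolution H φ u ∧ IsViscositySupersolution H φ u

/-- Local Lipschitz continuity on `𝕋^N × (0, ∞)` for the distance `|x - y| + |t - s|`. -/
def IsLocallyLipschitz {N m : ℕ} (u : Torus N → ℝ → Fin m → ℝ) : Prop :=
  ∀ (x₀ : Torus N) (t₀ : ℝ), 0 < t₀ → ∃ r κ : ℝ, 0 < r ∧ 0 < κ ∧
    ∀ (x y : Torus N) (t s : ℝ), 0 < t → 0 < s →
      dist x x₀ + |t - t₀| < r → dist y x₀ + |s - t₀| < r →
      ‖u x t - u y s‖ ≤ κ * (dist x y + |t - s|)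

end WeaklyCoupledHJ

/-!
Put `w_i = log (u_i + c)` with `c` so large that `v_i = u_i + c ≥ 1`. The equation becomes
`∂_t w_i + (h_i(x, v_i ∂_x w_i) + P_i(x, u)) / v_i = 0`, and convexity together with the quadratic
pinching of `h_i` makes `r ↦ h_i(x, r p) / r` increase by at least a multiple of `|p|² D` when
`log r` increases by `D`. Where `D = w_i(x, t) - w_i(y, s)` is the maximum over all indices of the
doubled differences, `|u(x, t) - u(y, s)|` and `|p| |x - y|` are `O(D)`, so that the dependence on
`x` and the coupling cost only `O(|p| D)`. For large `|p|` this contradicts the two viscosity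
inequalities. The weight `(t - a) (b - t)` replaces regularity of the initial data, so `∂_x u` is
bounded locally uniformly in `t > 0`. The Hamiltonian is then bounded along `u`, and comparison
with the paraboloids `C t + k |x - x₀|²` as `k → ∞` bounds `∂_t u`.
-/

namespace WeaklyCoupledHJ

open Filter Function Set
open scoped NNReal Topology

theorem lipschitzOnWith_uncurry {X Y Z : Type*} [PseudoMetricSpace X] [PseudoMetricSpace Y]
    [PseudoMetricSpace Z] {f : X → Y → Z} {s : Set X} {t : Set Y} {K C : ℝ≥0}
    (hK : ∀ y ∈ t, LipschitzOnWith K (fun x => f x y) s)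
    (hC : ∀ x ∈ s, LipschitzOnWith C (f x) t) :
    LipschitzOnWith (K + C) (uncurry f) (s ×ˢ t) := by
  refine LipschitzOnWith.of_dist_le_mul fun z hz z' hz' => ?_
  rw [NNReal.coe_add, add_mul]
  calc dist (f z.1 z.2) (f z'.1 z'.2)
      ≤ dist (f z.1 z.2) (f z'.1 z.2) + dist (f z'.1 z.2) (f z'.1 z'.2) := dist_triangle _ _ _
    _ ≤ K * dist z.1 z'.1 + C * dist z.2 z'.2 := add_le_add
        ((hK z.2 hz.2).dist_le_mul _ hz.1 _ hz'.1) ((hC z'.1 hz'.1).dist_le_mul _ hz.2 _ hz'.2)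
    _ ≤ K * dist z z' + C * dist z z' := by
        gcongr
        exacts [le_max_left _ _, le_max_right _ _]

/-! ### Quotients by closed subgroups -/

section Quotient

variable {E F : Type*} [NormedAddCommGroup E] [PseudoMetricSpace F] {Λ : AddSubgroup E}

theorem dist_mk_le_norm_sub (a b : E) : dist (a : E ⧸ Λ) (b : E ⧸ Λ) ≤ ‖a - b‖ := by
  rw [dist_eq_norm, ← QuotientAddGroup.mk_sub]
  exact QuotientAddGroup.norm_mk_le_norm

theorem exists_mk_eq_norm_sub_eq_dist [ProperSpace E] [hΛ : IsClosed (Λ : Set E)] (x : E ⧸ Λ)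
    (a : E) : ∃ b : E, (b : E ⧸ Λ) = x ∧ ‖b - a‖ = dist x (a : E ⧸ Λ) := by
  obtain ⟨b, rfl⟩ := QuotientAddGroup.mk_surjective x
  obtain ⟨k, hk, hd⟩ := hΛ.exists_infDist_eq_dist ⟨0, Λ.zero_mem⟩ (b - a)
  refine ⟨b - k, ?_, ?_⟩
  · rw [QuotientAddGroup.mk_sub, (QuotientAddGroup.eq_zero_iff k).2 hk, sub_zero]
  · rw [dist_eq_norm, ← QuotientAddGroup.mk_sub, QuotientAddGroup.norm_mk, hd, dist_eq_norm,
      sub_right_comm]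

theorem locallyLipschitz_of_comp_mk [ProperSpace E] [IsClosed (Λ : Set E)]
    {f : (E ⧸ Λ) × F → ℝ} (hf : LocallyLipschitz fun z : E × F => f (z.1, z.2)) :
    LocallyLipschitz f := by
  rintro ⟨x, b⟩
  obtain ⟨y, rfl⟩ := QuotientAddGroup.mk_surjective x
  obtain ⟨K, s, hs, hK⟩ := hf (y, b)
  obtain ⟨r, hr, hrs⟩ := Metric.mem_nhds_iff.1 hs
  refine ⟨K, _, Metric.ball_mem_nhds _ (show 0 < r / 3 by positivity),
    LipschitzOnWith.of_dist_le_mul fun z hz z' hz' => ?_⟩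
  rw [Metric.mem_ball, Prod.dist_eq, max_lt_iff] at hz hz'
  obtain ⟨y₁, h₁, hy₁⟩ := exists_mk_eq_norm_sub_eq_dist z.1 y
  obtain ⟨y₂, h₂, hy₂⟩ := exists_mk_eq_norm_sub_eq_dist z'.1 y₁
  rw [h₁] at hy₂
  rw [← dist_eq_norm] at hy₁ hy₂
  have hzz' := dist_triangle_right z.1 z'.1 (y : E ⧸ Λ)
  have htri := dist_triangle y₂ y₁ y
  have hmem₁ : (y₁, z.2) ∈ s := hrs (by
    rw [Metric.mem_ball, Prod.dist_eq]
    exact max_lt (by linarith) (by linarith))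
  have hmem₂ : (y₂, z'.2) ∈ s := hrs (by
    rw [Metric.mem_ball, Prod.dist_eq]
    exact max_lt (by linarith [dist_comm z.1 z'.1]) (by linarith))
  have h := hK.dist_le_mul _ hmem₁ _ hmem₂
  rwa [h₁, h₂, Prod.dist_eq, dist_comm y₁, hy₂, dist_comm z'.1, ← Prod.dist_eq] at h

end Quotient

section Torus

variable (N : ℕ)

instance isClosed_integerLattice : IsClosed (integerLattice N : Set (Euc N)) := by
  have h : (integerLattice N : Set (Euc N)) =
      ⋂ j, (fun v : Euc N => v j) ⁻¹' range ((↑) : ℤ → ℝ) := by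
    ext v
    simp only [mem_iInter, mem_preimage, mem_range]
    exact forall_congr' fun j => exists_congr fun k => eq_comm
  rw [h]
  exact isClosed_iInter fun j =>
    Int.isClosedEmbedding_coe_real.isClosed_range.preimage (by fun_prop)

instance compactSpace_torus : CompactSpace (Torus N) := by
  let cube : Set (Euc N) := WithLp.toLp 2 '' Icc 0 1
  have hcube : IsCompact cube := isCompact_Icc.image (PiLp.continuous_toLp 2 _)
  have hsurj : (fun y : Euc N => (y : Torus N)) '' cube = univ := by
    refine eq_univ_of_forall fun x => ?_
    obtain ⟨y, rfl⟩ := QuotientAddGroup.mk_surjective x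
    refine ⟨_, ⟨fun j => Int.fract (y j), ⟨fun j => Int.fract_nonneg _,
      fun j => (Int.fract_lt_one _).le⟩, rfl⟩, QuotientAddGroup.eq.2 fun j => ⟨⌊y j⌋, ?_⟩⟩
    simp only [PiLp.add_apply, PiLp.neg_apply, Int.fract]
    ring
  exact ⟨hsurj ▸ hcube.image continuous_quotient_mk'⟩

end Torus

/-! ### Gradients and convex functions of quadratic growth -/

section Gradient

variable {E : Type*} [NormedAddCommGroup E] [InnerProductSpace ℝ E] [CompleteSpace E]

theorem hasGradientAt_comp_of_hasDerivAt {g : ℝ → ℝ} {f : E → ℝ} {c : ℝ} {q x : E}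
    (hg : HasDerivAt g c (f x)) (hf : HasGradientAt f q x) :
    HasGradientAt (fun z => g (f z)) (c • q) x := by
  rw [hasGradientAt_iff_hasFDerivAt] at hf ⊢
  rw [map_smul]
  exact hg.comp_hasFDerivAt x hf

theorem hasGradientAt_norm_sub_sq (x c : E) :
    HasGradientAt (fun z => ‖z - c‖ ^ 2) ((2 : ℝ) • (x - c)) x := by
  refine hasGradientAt_iff_hasFDerivAt.2
    (((hasFDerivAt_id x).sub_const c).norm_sq.congr_fderiv (ContinuousLinearMap.ext fun z => ?_))
  simp [two_smul]

theorem hasGradientAt_norm_sub {x c : E} (h : x ≠ c) :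
    HasGradientAt (fun z => ‖z - c‖) (NormedSpace.normalize (x - c)) x := by
  have hne : ‖x - c‖ ≠ 0 := norm_ne_zero_iff.2 (sub_ne_zero.2 h)
  have hsqrt := hasGradientAt_comp_of_hasDerivAt (f := fun z => ‖z - c‖ ^ 2)
    (Real.hasDerivAt_sqrt (pow_ne_zero 2 hne)) (hasGradientAt_norm_sub_sq x c)
  simp only [Real.sqrt_sq (norm_nonneg _), smul_smul] at hsqrt
  convert hsqrt using 1
  rw [NormedSpace.normalize]
  congr 1
  field_simp

end Gradient

section ScalingGap

variable {E : Type*} [NormedAddCommGroup E] [NormedSpace ℝ E] {f : E → ℝ} {a A : ℝ}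

/- Convexity along the ray through `r • p`, `p`, `μ • p` with `r = a / (2 * A)`: at `r • p` the
upper bound puts `f` below `r • (lower bound at p)`, so the chord slope at `p` exceeds `f p`. -/
theorem mul_sq_norm_le_apply_smul_sub (hf : ConvexOn ℝ univ f) (ha : 0 < a)
    (hlow : ∀ p, a * ‖p‖ ^ 2 ≤ f p) (hup : ∀ p, f p ≤ A * ‖p‖ ^ 2) {μ : ℝ} (hμ : 1 < μ) (p : E) :
    a ^ 2 / (4 * A) * (μ - 1) * ‖p‖ ^ 2 ≤ f (μ • p) - μ * f p := by
  rcases eq_or_ne p 0 with rfl | hp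
  · have h0 : f 0 = 0 := le_antisymm (by simpa using hup 0) (by simpa using hlow 0)
    simp [h0]
  have hn : 0 < ‖p‖ ^ 2 := by positivity
  have haA : a ≤ A := le_of_mul_le_mul_right ((hlow p).trans (hup p)) hn
  have hA : 0 < A := ha.trans_le haA
  set r := a / (2 * A) with hr
  have hr0 : 0 < r := by positivity
  have hr1 : r < 1 := by rw [hr, div_lt_one (by positivity)]; linarith
  have hAr : A * r = a / 2 := by rw [hr]; field_simp
  have hslope := (hf.comp_linearMap (LinearMap.toSpanSingleton ℝ E p)).slope_mono_adjacent
    (mem_univ r) (mem_univ μ) hr1 hμ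
  simp only [comp_apply, LinearMap.toSpanSingleton_apply, one_smul] at hslope
  have hrp : f (r • p) ≤ r * (a / 2 * ‖p‖ ^ 2) := by
    refine (hup _).trans_eq ?_
    rw [norm_smul, Real.norm_of_nonneg hr0.le, ← hAr]
    ring
  have hchord : f p + r * (a / 2 * ‖p‖ ^ 2) ≤ (f p - f (r • p)) / (1 - r) := by
    rw [le_div_iff₀ (by linarith)]
    nlinarith [mul_le_mul_of_nonneg_left (hlow p) hr0.le, mul_pos hr0 (mul_pos ha hn)]
  have hgain := (le_div_iff₀ (by linarith)).1 (hchord.trans hslope)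
  have hc : a ^ 2 / (4 * A) = r * (a / 2) := by rw [hr]; field_simp; norm_num
  rw [hc]
  linarith

theorem mul_sq_norm_le_apply_smul_div_sub (hf : ConvexOn ℝ univ f) (ha : 0 < a)
    (hlow : ∀ p, a * ‖p‖ ^ 2 ≤ f p) (hup : ∀ p, f p ≤ A * ‖p‖ ^ 2) {r s : ℝ} (hr : 0 < r)
    (hrs : r < s) (p : E) :
    a ^ 2 / (4 * A) * ‖p‖ ^ 2 * (r * (s - r) / s) ≤ f (s • p) / s - f (r • p) / r := by
  have hs : 0 < s := hr.trans hrs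
  have h := mul_sq_norm_le_apply_smul_sub hf ha hlow hup ((one_lt_div hr).2 hrs) (r • p)
  rw [smul_smul, div_mul_cancel₀ _ hr.ne', norm_smul, Real.norm_of_nonneg hr.le] at h
  calc a ^ 2 / (4 * A) * ‖p‖ ^ 2 * (r * (s - r) / s)
      = a ^ 2 / (4 * A) * (s / r - 1) * (r * ‖p‖) ^ 2 / s := by field_simp
    _ ≤ (f (s • p) - s / r * f (r • p)) / s := div_le_div_of_nonneg_right h hs.le
    _ = f (s • p) / s - f (r • p) / r := by field_simp

end ScalingGap

section Log

variable {r s M : ℝ}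

theorem sub_le_mul_log_sub_log (hr : 0 < r) (hrs : r ≤ s) (hs : s ≤ M) :
    s - r ≤ M * (Real.log s - Real.log r) := by
  have hs0 : 0 < s := hr.trans_le hrs
  have hlog := Real.one_sub_inv_le_log_of_pos (div_pos hs0 hr)
  rw [Real.log_div hs0.ne' hr.ne', inv_div] at hlog
  have hpos : 0 ≤ 1 - r / s := sub_nonneg.2 ((div_le_one hs0).2 hrs)
  calc s - r = s * (1 - r / s) := by field_simp
    _ ≤ M * (Real.log s - Real.log r) := mul_le_mul hs hlog hpos (hs0.le.trans hs)

theorem abs_sub_le_mul_abs_log_sub_log (hr : 0 < r) (hs : 0 < s) (hrM : r ≤ M) (hsM : s ≤ M) :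
    |s - r| ≤ M * |Real.log s - Real.log r| := by
  wlog h : r ≤ s generalizing r s
  · rw [abs_sub_comm s, abs_sub_comm (Real.log s)]
    exact this hs hr hsM hrM (le_of_not_ge h)
  rw [abs_of_nonneg (sub_nonneg.2 h), abs_of_nonneg (sub_nonneg.2 (Real.log_le_log hr h))]
  exact sub_le_mul_log_sub_log hr h hsM

theorem log_sub_log_le_mul_sub (hr : 1 ≤ r) (hs : 0 < s) (hrs : r ≤ s) :
    Real.log s - Real.log r ≤ r * (s - r) := by
  have hr0 : 0 < r := one_pos.trans_le hr
  have hlog := Real.log_le_sub_one_of_pos (div_pos hs hr0)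
  rw [Real.log_div hs.ne' hr0.ne'] at hlog
  calc Real.log s - Real.log r ≤ (s - r) / r := by rwa [sub_div, div_self hr0.ne']
    _ ≤ s - r := div_le_self (sub_nonneg.2 hrs) hr
    _ ≤ r * (s - r) := le_mul_of_one_le_left (sub_nonneg.2 hrs) hr

end Log

/-! ### Viscosity inequalities -/

section TestFunction

variable {E : Type*} [NormedAddCommGroup E]

section Normed

variable [NormedSpace ℝ E] {f : E × ℝ → ℝ} {y : E} {t c : ℝ}

theorem hasDerivAt_time_of_contDiffAt (hf : ContDiffAt ℝ 1 f (y, t)) :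
    HasDerivAt (fun s => f (y, s)) (deriv (fun s => f (y, s)) t) t :=
  ((hf.differentiableAt one_ne_zero).comp (f := fun s => (y, s)) t (by fun_prop)).hasDerivAt

theorem contDiffAt_mul_exp_sub (hf : ContDiffAt ℝ 1 f (y, t)) :
    ContDiffAt ℝ 1 (fun z => c * Real.exp (f z - f (y, t))) (y, t) :=
  contDiffAt_const.mul (hf.sub contDiffAt_const).exp

theorem hasDerivAt_mul_exp_sub (hf : ContDiffAt ℝ 1 f (y, t)) :
    HasDerivAt (fun s => c * Real.exp (f (y, s) - f (y, t)))
      (c * deriv (fun s => f (y, s)) t) t := by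
  simpa using (((hasDerivAt_time_of_contDiffAt hf).sub_const (f (y, t))).exp).const_mul c

end Normed

variable [InnerProductSpace ℝ E] [CompleteSpace E] {f : E × ℝ → ℝ} {y : E} {t c : ℝ}

theorem hasGradientAt_space_of_contDiffAt (hf : ContDiffAt ℝ 1 f (y, t)) :
    HasGradientAt (fun z => f (z, t)) (gradient (fun z => f (z, t)) y) y :=
  ((hf.differentiableAt one_ne_zero).comp (f := fun z => (z, t)) y (by fun_prop)).hasGradientAt

theorem hasGradientAt_mul_exp_sub (hf : ContDiffAt ℝ 1 f (y, t)) :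
    HasGradientAt (fun z => c * Real.exp (f (z, t) - f (y, t)))
      (c • gradient (fun z => f (z, t)) y) y := by
  have hexp : HasDerivAt (fun r => c * Real.exp (r - f (y, t))) c (f (y, t)) := by
    simpa using ((hasDerivAt_id (f (y, t))).sub_const (f (y, t))).exp.const_mul c
  exact hasGradientAt_comp_of_hasDerivAt (f := fun z => f (z, t)) hexp
    (hasGradientAt_space_of_contDiffAt hf)

end TestFunction

section Viscosity

variable {E : Type*} [NormedAddCommGroup E] [InnerProductSpace ℝ E] [CompleteSpace E]
  {Λ : AddSubgroup E} {F : E ⧸ Λ → ℝ → E → ℝ} {I J : Set ℝ} {v : E ⧸ Λ → ℝ → ℝ}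

/-- Viscosity subsolutions of the scalar equation `∂_t v + F(x, t, ∂_x v) = 0` on
`(E ⧸ Λ) × I`, tested in the chart `E → E ⧸ Λ`. In a system, the `i`-th unknown solves such an
equation in which `F` contains the values of all the unknowns as functions of `(x, t)`. -/
def IsSubsolutionOn (F : E ⧸ Λ → ℝ → E → ℝ) (I : Set ℝ) (v : E ⧸ Λ → ℝ → ℝ) : Prop :=
  ∀ (y : E), ∀ t ∈ I, ∀ f : E × ℝ → ℝ, ContDiffAt ℝ 1 f (y, t) →
    IsLocalMax (fun z : E × ℝ => v z.1 z.2 - f z) (y, t) →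
    deriv (fun s => f (y, s)) t + F y t (gradient (fun z => f (z, t)) y) ≤ 0

/-- Viscosity supersolutions of `∂_t v + F(x, t, ∂_x v) = 0` on `(E ⧸ Λ) × I`. -/
def IsSupersolutionOn (F : E ⧸ Λ → ℝ → E → ℝ) (I : Set ℝ) (v : E ⧸ Λ → ℝ → ℝ) : Prop :=
  ∀ (y : E), ∀ t ∈ I, ∀ f : E × ℝ → ℝ, ContDiffAt ℝ 1 f (y, t) →
    IsLocalMin (fun z : E × ℝ => v z.1 z.2 - f z) (y, t) →
    0 ≤ deriv (fun s => f (y, s)) t + F y t (gradient (fun z => f (z, t)) y)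

/-- Viscosity solutions on `(E ⧸ Λ) × I` of the weakly coupled system
`∂_t u_i + H_i(x, ∂_x u_i, u) = 0`. -/
structure IsViscositySolutionOn {ι : Type*} (H : ι → E ⧸ Λ → E → (ι → ℝ) → ℝ) (I : Set ℝ)
    (u : E ⧸ Λ → ℝ → ι → ℝ) : Prop where
  continuousOn : ContinuousOn (fun z : (E ⧸ Λ) × ℝ => u z.1 z.2) (univ ×ˢ I)
  isSubsolutionOn : ∀ i,
    IsSubsolutionOn (fun x t p => H i x p (u x t)) I fun x t => u x t i
  isSupersolutionOn : ∀ i,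
    IsSupersolutionOn (fun x t p => H i x p (u x t)) I fun x t => u x t i

theorem IsSubsolutionOn.mono (hv : IsSubsolutionOn F I v) (hJ : J ⊆ I) :
    IsSubsolutionOn F J v :=
  fun y t ht => hv y t (hJ ht)

theorem IsSupersolutionOn.mono (hv : IsSupersolutionOn F I v) (hJ : J ⊆ I) :
    IsSupersolutionOn F J v :=
  fun y t ht => hv y t (hJ ht)

theorem IsSubsolutionOn.add_const (hv : IsSubsolutionOn F I v) (c : ℝ) :
    IsSubsolutionOn F I fun x t => v x t + c := fun y t ht f hf hmax =>
  hv y t ht f hf (hmax.mono fun z hz => by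
    dsimp only at hz
    linarith)

theorem IsSupersolutionOn.add_const (hv : IsSupersolutionOn F I v) (c : ℝ) :
    IsSupersolutionOn F I fun x t => v x t + c := fun y t ht f hf hmin =>
  hv y t ht f hf (hmin.mono fun z hz => by
    dsimp only at hz
    linarith)

theorem IsSubsolutionOn.add_le_zero (hv : IsSubsolutionOn F I v) {y : E} {t : ℝ} (ht : t ∈ I)
    {f : E × ℝ → ℝ} (hf : ContDiffAt ℝ 1 f (y, t))
    (hmax : IsLocalMax (fun z : E × ℝ => v z.1 z.2 - f z) (y, t)) {b : ℝ} {q : E}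
    (hb : HasDerivAt (fun s => f (y, s)) b t) (hq : HasGradientAt (fun z => f (z, t)) q y) :
    b + F y t q ≤ 0 := by
  simpa only [hb.deriv, hq.gradient] using hv y t ht f hf hmax

theorem IsSupersolutionOn.zero_le_add (hv : IsSupersolutionOn F I v) {y : E} {t : ℝ} (ht : t ∈ I)
    {f : E × ℝ → ℝ} (hf : ContDiffAt ℝ 1 f (y, t))
    (hmin : IsLocalMin (fun z : E × ℝ => v z.1 z.2 - f z) (y, t)) {b : ℝ} {q : E}
    (hb : HasDerivAt (fun s => f (y, s)) b t) (hq : HasGradientAt (fun z => f (z, t)) q y) :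
    0 ≤ b + F y t q := by
  simpa only [hb.deriv, hq.gradient] using hv y t ht f hf hmin

theorem IsSupersolutionOn.neg (hv : IsSupersolutionOn F I v) :
    IsSubsolutionOn (fun x t p => -F x t (-p)) I fun x t => -v x t := by
  intro y t ht f hf hmax
  have hq := hasGradientAt_comp_of_hasDerivAt (hasDerivAt_neg _)
    (hasGradientAt_space_of_contDiffAt hf)
  have h := hv.zero_le_add ht hf.neg (hmax.neg.congr (.of_forall fun z => by ring))
    (hasDerivAt_time_of_contDiffAt hf).neg hq
  rw [neg_one_smul] at h
  linarith

/- The test function `v (y, t) * exp (f - f (y, t))` for `v` has the derivatives of `f`, multiplied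
by `v (y, t)`, at `(y, t)`. -/
theorem IsSubsolutionOn.log (hv : IsSubsolutionOn F I v) (hI : IsOpen I)
    (hpos : ∀ x, ∀ t ∈ I, 0 < v x t) :
    IsSubsolutionOn (fun x t p => F x t (v x t • p) / v x t) I
      fun x t => Real.log (v x t) := by
  intro y t ht f hf hmax
  have hvt := hpos y t ht
  have htest := hv.add_le_zero ht (contDiffAt_mul_exp_sub (c := v y t) hf) (by
    filter_upwards [hmax, continuousAt_snd.eventually (hI.mem_nhds ht)] with z hz hzI
    have hle : Real.log (v z.1 z.2) ≤ Real.log (v y t) + (f z - f (y, t)) := by linarith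
    rw [Real.log_le_iff_le_exp (hpos _ _ hzI), Real.exp_add, Real.exp_log hvt] at hle
    simpa using hle) (hasDerivAt_mul_exp_sub hf) (hasGradientAt_mul_exp_sub hf)
  have hdiv := div_nonpos_of_nonpos_of_nonneg htest hvt.le
  rwa [add_div, mul_div_cancel_left₀ _ hvt.ne'] at hdiv

theorem IsSupersolutionOn.log (hv : IsSupersolutionOn F I v) (hI : IsOpen I)
    (hpos : ∀ x, ∀ t ∈ I, 0 < v x t) :
    IsSupersolutionOn (fun x t p => F x t (v x t • p) / v x t) I
      fun x t => Real.log (v x t) := by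
  intro y t ht f hf hmin
  have hvt := hpos y t ht
  have htest := hv.zero_le_add ht (contDiffAt_mul_exp_sub (c := v y t) hf) (by
    filter_upwards [hmin, continuousAt_snd.eventually (hI.mem_nhds ht)] with z hz hzI
    have hle : Real.log (v y t) + (f z - f (y, t)) ≤ Real.log (v z.1 z.2) := by linarith
    rw [Real.le_log_iff_exp_le (hpos _ _ hzI), Real.exp_add, Real.exp_log hvt] at hle
    simpa using hle) (hasDerivAt_mul_exp_sub hf) (hasGradientAt_mul_exp_sub hf)
  have hdiv := div_nonneg htest hvt.le
  rwa [add_div, mul_div_cancel_left₀ _ hvt.ne'] at hdiv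

end Viscosity

/-! ### Doubling of variables -/

/-- The weight `(t - a) (b - t)` which confines the doubling argument to times inside `[a, b]`. -/
def timeWeight (a b t : ℝ) : ℝ :=
  (t - a) * (b - t)

theorem timeWeight_nonneg {a b t : ℝ} (ht : t ∈ Icc a b) : 0 ≤ timeWeight a b t :=
  mul_nonneg (sub_nonneg.2 ht.1) (sub_nonneg.2 ht.2)

theorem timeWeight_pos {a b t : ℝ} (ht : t ∈ Ioo a b) : 0 < timeWeight a b t :=
  mul_pos (sub_pos.2 ht.1) (sub_pos.2 ht.2)

theorem timeWeight_le_left {a b t : ℝ} (ht : t ∈ Icc a b) :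
    timeWeight a b t ≤ (t - a) * (b - a) :=
  mul_le_mul_of_nonneg_left (sub_le_sub_left ht.1 b) (sub_nonneg.2 ht.1)

theorem timeWeight_le_right {a b t : ℝ} (ht : t ∈ Icc a b) :
    timeWeight a b t ≤ (b - t) * (b - a) := by
  rw [timeWeight, mul_comm]
  exact mul_le_mul_of_nonneg_left (sub_le_sub_right ht.2 a) (sub_nonneg.2 ht.2)

theorem timeWeight_le_sq {a b t : ℝ} (ht : t ∈ Icc a b) : timeWeight a b t ≤ (b - a) ^ 2 := by
  rw [sq]
  exact mul_le_mul (sub_le_sub_right ht.2 a) (sub_le_sub_left ht.1 b) (sub_nonneg.2 ht.2)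
    (sub_nonneg.2 (ht.1.trans ht.2))

theorem hasDerivAt_timeWeight (a b t : ℝ) : HasDerivAt (timeWeight a b) (a + b - 2 * t) t := by
  refine (((hasDerivAt_id t).sub_const a).mul ((hasDerivAt_id t).const_sub b)).congr_deriv ?_
  simp only [id]
  ring

theorem contDiff_timeWeight (a b : ℝ) {n : ℕ∞} : ContDiff ℝ n (timeWeight a b) := by
  unfold timeWeight
  fun_prop

section Doubling

variable {X ι : Type*} [PseudoMetricSpace X] {w : X → ℝ → ι → ℝ} {a b K ε W δ : ℝ} {i : ι}
  {x y : X} {t s : ℝ}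

/-- The functional `τ(t) (w_i(x, t) - w_i(y, s)) - K d(x, y) - (t - s)² / ε` with doubled
variables, `τ` being `timeWeight a b`. -/
noncomputable def doubling (w : X → ℝ → ι → ℝ) (a b K ε : ℝ) (i : ι) (x : X) (t : ℝ) (y : X)
    (s : ℝ) : ℝ :=
  timeWeight a b t * (w x t i - w y s i) - (K * dist x y + (t - s) ^ 2 / ε)

/-- `(i, x, t, y, s)` is a maximum point of `doubling` among all indices, all points and all
times in `[a, b]`. -/
structure IsDoublingMax (w : X → ℝ → ι → ℝ) (a b K ε : ℝ) (i : ι) (x : X) (t : ℝ) (y : X)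
    (s : ℝ) : Prop where
  left_mem : t ∈ Icc a b
  right_mem : s ∈ Icc a b
  doubling_le : ∀ j x', ∀ t' ∈ Icc a b, ∀ y', ∀ s' ∈ Icc a b,
    doubling w a b K ε j x' t' y' s' ≤ doubling w a b K ε i x t y s

theorem doubling_le_timeWeight_mul (hK : 0 ≤ K) (hε : 0 ≤ ε) :
    doubling w a b K ε i x t y s ≤ timeWeight a b t * (w x t i - w y s i) :=
  sub_le_self _ (by positivity)

theorem sub_pos_of_doubling_pos (hK : 0 ≤ K) (hε : 0 ≤ ε) (ht : t ∈ Icc a b)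
    (h : 0 < doubling w a b K ε i x t y s) : 0 < w x t i - w y s i :=
  pos_of_mul_pos_right (h.trans_le (doubling_le_timeWeight_mul hK hε)) (timeWeight_nonneg ht)

theorem timeWeight_pos_of_doubling_pos (hK : 0 ≤ K) (hε : 0 ≤ ε) (ht : t ∈ Icc a b)
    (h : 0 < doubling w a b K ε i x t y s) : 0 < timeWeight a b t :=
  pos_of_mul_pos_left (h.trans_le (doubling_le_timeWeight_mul hK hε))
    (sub_pos_of_doubling_pos hK hε ht h).le

theorem mem_Ioo_of_doubling_pos (hK : 0 ≤ K) (hε : 0 ≤ ε) (ht : t ∈ Icc a b)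
    (h : 0 < doubling w a b K ε i x t y s) : t ∈ Ioo a b := by
  have hτ := timeWeight_pos_of_doubling_pos hK hε ht h
  exact ⟨sub_pos.1 (pos_of_mul_pos_left hτ (sub_nonneg.2 ht.2)),
    sub_pos.1 (pos_of_mul_pos_right hτ (sub_nonneg.2 ht.1))⟩

theorem abs_sub_lt_of_doubling_pos (hK : 0 ≤ K) (hδ : 0 < δ) (hW0 : 0 ≤ W)
    (hW : w x t i - w y s i ≤ W) (ht : t ∈ Icc a b)
    (h : 0 < doubling w a b K (δ ^ 2 / ((b - a) ^ 2 * W + 1)) i x t y s) : |t - s| < δ := by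
  have hQ : 0 < (b - a) ^ 2 * W + 1 := by positivity
  have hτW : timeWeight a b t * (w x t i - w y s i) ≤ (b - a) ^ 2 * W :=
    mul_le_mul (timeWeight_le_sq ht) hW
      (sub_pos_of_doubling_pos hK (by positivity) ht h).le (by positivity)
  have hpen : (t - s) ^ 2 / (δ ^ 2 / ((b - a) ^ 2 * W + 1)) < (b - a) ^ 2 * W + 1 := by
    have := mul_nonneg hK (dist_nonneg (x := x) (y := y))
    rw [doubling] at h
    linarith
  rw [div_lt_iff₀ (by positivity), mul_div_cancel₀ _ hQ.ne'] at hpen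
  exact abs_lt_of_sq_lt_sq hpen hδ.le

theorem lt_sub_of_lt_doubling (hK : 0 ≤ K) (hε : 0 ≤ ε) (hW0 : 0 ≤ W)
    (hW : w x t i - w y s i ≤ W) (ht : t ∈ Icc a b)
    (h : δ * ((b - a) * W) < doubling w a b K ε i x t y s) : δ < t - a ∧ δ < b - t := by
  have hab : 0 ≤ (b - a) * W := mul_nonneg (sub_nonneg.2 (ht.1.trans ht.2)) hW0
  have hτW : δ * ((b - a) * W) < timeWeight a b t * W :=
    (h.trans_le (doubling_le_timeWeight_mul hK hε)).trans_le
      (mul_le_mul_of_nonneg_left hW (timeWeight_nonneg ht))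
  constructor <;> refine lt_of_mul_lt_mul_right (hτW.trans_le ?_) hab <;> rw [← mul_assoc]
  · exact mul_le_mul_of_nonneg_right (timeWeight_le_left ht) hW0
  · exact mul_le_mul_of_nonneg_right (timeWeight_le_right ht) hW0

theorem IsDoublingMax.norm_sub_le [Fintype ι] (hmax : IsDoublingMax w a b K ε i x t y s)
    (hτ : 0 < timeWeight a b t) (hmod : ∀ z, ‖w z t - w z s‖ ≤ w x t i - w y s i) :
    ‖w x t - w y s‖ ≤ 3 * (w x t i - w y s i) := by
  have hD := (norm_nonneg _).trans (hmod x)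
  refine (pi_norm_le_iff_of_nonneg (by positivity)).2 fun j => ?_
  have hx := abs_le.1 ((norm_le_pi_norm (w x t - w x s) j).trans (hmod x))
  have hy := abs_le.1 ((norm_le_pi_norm (w y t - w y s) j).trans (hmod y))
  have hxy := hmax.doubling_le j x t hmax.left_mem y s hmax.right_mem
  have hyx := hmax.doubling_le j y t hmax.left_mem x s hmax.right_mem
  simp only [doubling, dist_comm y, sub_le_sub_iff_right, mul_le_mul_iff_right₀ hτ] at hxy hyx
  simp only [Pi.sub_apply] at hx hy
  rw [Pi.sub_apply, Real.norm_eq_abs, abs_le]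
  constructor <;> linarith [hx.1, hx.2, hy.1, hy.2]

variable [CompactSpace X]

theorem exists_isDoublingMax [Finite ι] [Nonempty X] [Nonempty ι] (hab : a ≤ b)
    (hw : ContinuousOn (fun z : X × ℝ => w z.1 z.2) (univ ×ˢ Icc a b)) (K ε : ℝ) :
    ∃ i x t y s, IsDoublingMax w a b K ε i x t y s := by
  let C : Set ((X × ℝ) × (X × ℝ)) := (univ ×ˢ Icc a b) ×ˢ (univ ×ˢ Icc a b)
  have hC : IsCompact C :=
    (isCompact_univ.prod isCompact_Icc).prod (isCompact_univ.prod isCompact_Icc)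
  have hne : C.Nonempty := by simp [C, hab]
  have hcont : ∀ j, ContinuousOn (fun z => doubling w a b K ε j z.1.1 z.1.2 z.2.1 z.2.2) C := by
    intro j
    have hw₁ : ContinuousOn (fun z : (X × ℝ) × (X × ℝ) => w z.1.1 z.1.2 j) C :=
      (continuousOn_pi.1 hw j).comp (t := univ ×ˢ Icc a b) continuousOn_fst fun z hz => hz.1
    have hw₂ : ContinuousOn (fun z : (X × ℝ) × (X × ℝ) => w z.2.1 z.2.2 j) C :=
      (continuousOn_pi.1 hw j).comp (t := univ ×ˢ Icc a b) continuousOn_snd fun z hz => hz.2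
    have hτ : Continuous fun z : (X × ℝ) × (X × ℝ) => timeWeight a b z.1.2 :=
      (contDiff_timeWeight a b (n := 0)).continuous.comp (by fun_prop)
    have hpen : Continuous fun z : (X × ℝ) × (X × ℝ) =>
      K * dist z.1.1 z.2.1 + (z.1.2 - z.2.2) ^ 2 / ε := by fun_prop
    exact (hτ.continuousOn.mul (hw₁.sub hw₂)).sub hpen.continuousOn
  choose z hzC hz using fun j => hC.exists_isMaxOn hne (hcont j)
  obtain ⟨i, hi⟩ := Finite.exists_max fun j =>
    doubling w a b K ε j (z j).1.1 (z j).1.2 (z j).2.1 (z j).2.2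
  exact ⟨i, _, _, _, _, (hzC i).1.2, (hzC i).2.2, fun j x' t' ht' y' s' hs' =>
    (hz j (show ((x', t'), (y', s')) ∈ C from ⟨⟨trivial, ht'⟩, trivial, hs'⟩)).trans (hi j)⟩

theorem exists_sub_le [Finite ι]
    (hw : ContinuousOn (fun z : X × ℝ => w z.1 z.2) (univ ×ˢ Icc a b)) :
    ∃ W ≥ 0, ∀ i x, ∀ t ∈ Icc a b, ∀ y, ∀ s ∈ Icc a b, w x t i - w y s i ≤ W := by
  have := Fintype.ofFinite ι
  obtain ⟨C, hC⟩ := (isCompact_univ.prod isCompact_Icc).exists_bound_of_continuousOn hw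
  refine ⟨|C + C|, abs_nonneg _, fun i x t ht y s hs => ?_⟩
  calc w x t i - w y s i ≤ ‖(w x t - w y s) i‖ := le_abs_self _
    _ ≤ ‖w x t - w y s‖ := norm_le_pi_norm _ i
    _ ≤ C + C := (norm_sub_le _ _).trans
        (add_le_add (hC (x, t) ⟨trivial, ht⟩) (hC (y, s) ⟨trivial, hs⟩))
    _ ≤ |C + C| := le_abs_self _

variable [Fintype ι]

theorem exists_time_modulus (hw : ContinuousOn (fun z : X × ℝ => w z.1 z.2) (univ ×ˢ Icc a b))
    {η : ℝ} (hη : 0 < η) :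
    ∃ δ > 0, ∀ x, ∀ t ∈ Icc a b, ∀ s ∈ Icc a b, |t - s| < δ → ‖w x t - w x s‖ < η := by
  have huc := (isCompact_univ.prod isCompact_Icc).uniformContinuousOn_of_continuous hw
  obtain ⟨δ, hδ, h⟩ := Metric.uniformContinuousOn_iff.1 huc η hη
  refine ⟨δ, hδ, fun x t ht s hs hts => ?_⟩
  rw [← dist_eq_norm]
  exact h (x, t) ⟨trivial, ht⟩ (x, s) ⟨trivial, hs⟩
    (by rwa [dist_prod_same_left, Real.dist_eq])

theorem exists_isDoublingMax_of_lt
    (hw : ContinuousOn (fun z : X × ℝ => w z.1 z.2) (univ ×ˢ Icc a b)) (hK : 0 ≤ K)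
    (ht : t ∈ Icc a b) (hlt : K * dist x y < timeWeight a b t * (w x t i - w y t i)) :
    ∃ ε > 0, ∃ i x t y s, IsDoublingMax w a b K ε i x t y s ∧
      0 < doubling w a b K ε i x t y s ∧ s ∈ Ioo a b ∧ x ≠ y ∧
      ‖w x t - w y s‖ ≤ 3 * (w x t i - w y s i) := by
  have : Nonempty X := ⟨x⟩
  have : Nonempty ι := ⟨i⟩
  obtain ⟨W, hW0, hW⟩ := exists_sub_le hw
  have hab : a ≤ b := ht.1.trans ht.2
  obtain ⟨M, hM, hMlt⟩ : ∃ M > 0, K * dist x y + M = timeWeight a b t * (w x t i - w y t i) :=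
    ⟨_, sub_pos.2 hlt, add_sub_cancel _ _⟩
  obtain ⟨δ₁, hδ₁, hmod⟩ := exists_time_modulus hw (η := M / ((b - a) ^ 2 + 1)) (by positivity)
  obtain ⟨δ₂, hδ₂, hδM⟩ := exists_pos_mul_lt hM ((b - a) * W)
  let δ := min δ₁ δ₂
  have hδ : 0 < δ := lt_min hδ₁ hδ₂
  let ε := δ ^ 2 / ((b - a) ^ 2 * W + 1)
  have hε : 0 < ε := by positivity
  obtain ⟨i', x', t', y', s', hmax⟩ := exists_isDoublingMax hab hw K ε
  have hMle : M ≤ doubling w a b K ε i' x' t' y' s' := by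
    refine le_trans (le_of_eq ?_) (hmax.doubling_le i x t ht y t ht)
    rw [doubling, ← hMlt]
    simp
  have hpos := hM.trans_le hMle
  have ht' := hmax.left_mem
  have hs' := hmax.right_mem
  have hD := sub_pos_of_doubling_pos hK hε.le ht' hpos
  have hts := abs_sub_lt_of_doubling_pos hK hδ hW0 (hW i' x' t' ht' y' s' hs') ht' hpos
  have hδt := lt_sub_of_lt_doubling (δ := δ) hK hε.le hW0
    (hW i' x' t' ht' y' s' hs') ht' (by
      refine lt_of_le_of_lt ?_ (hδM.trans_le hMle)
      rw [mul_comm]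
      exact mul_le_mul_of_nonneg_left (min_le_right _ _)
        (mul_nonneg (sub_nonneg.2 hab) hW0))
  have hmod' : ∀ z, ‖w z t' - w z s'‖ < w x' t' i' - w y' s' i' := by
    refine fun z => (hmod z t' ht' s' hs' (hts.trans_le (min_le_left _ _))).trans_le ?_
    rw [div_le_iff₀ (by positivity), mul_comm]
    exact (hMle.trans (doubling_le_timeWeight_mul hK hε.le)).trans
      (mul_le_mul_of_nonneg_right ((timeWeight_le_sq ht').trans (by linarith)) hD.le)
  have hne : x' ≠ y' := by
    rintro rfl
    exact (norm_le_pi_norm (w x' t' - w x' s') i').not_gt ((hmod' x').trans_le (le_abs_self _))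
  have hts' := abs_lt.1 hts
  exact ⟨ε, hε, i', x', t', y', s', hmax, hpos, ⟨by linarith [hδt.1], by linarith [hδt.2]⟩,
    hne, hmax.norm_sub_le (timeWeight_pos_of_doubling_pos hK hε.le ht' hpos)
      fun z => (hmod' z).le⟩

end Doubling

section DoublingViscosity

variable {E ι : Type*} [NormedAddCommGroup E] [InnerProductSpace ℝ E] {Λ : AddSubgroup E}
  {w : E ⧸ Λ → ℝ → ι → ℝ} {a b K ε : ℝ} {i : ι} {p q : E} {t s : ℝ}

theorem contDiffAt_norm_fst_sub (hpq : p ≠ q) (t : ℝ) :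
    ContDiffAt ℝ 1 (fun z : E × ℝ => ‖z.1 - q‖) (p, t) :=
  (contDiffAt_fst.sub contDiffAt_const).norm ℝ (sub_ne_zero.2 hpq)

theorem IsDoublingMax.add_le_zero [CompleteSpace E] {F : E ⧸ Λ → ℝ → E → ℝ}
    (hmax : IsDoublingMax w a b K ε i p t q s) (hK : 0 ≤ K) (ht : t ∈ Ioo a b) (hpq : p ≠ q)
    (hdist : ‖p - q‖ = dist (p : E ⧸ Λ) q)
    (hw : IsSubsolutionOn F (Ioo a b) fun x t => w x t i) :
    (2 * (t - s) / ε - (w p t i - w q s i) * (a + b - 2 * t)) / timeWeight a b t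
      + F p t ((K / timeWeight a b t) • NormedSpace.normalize (p - q)) ≤ 0 := by
  let Φ := doubling w a b K ε i p t q s
  let f : E × ℝ → ℝ := fun z =>
    (Φ + K * ‖z.1 - q‖ + (z.2 - s) ^ 2 / ε) / timeWeight a b z.2
  have hτ := timeWeight_pos ht
  have hf_self : Φ + K * ‖p - q‖ + (t - s) ^ 2 / ε = (w p t i - w q s i) * timeWeight a b t := by
    simp only [Φ, doubling, hdist]
    ring
  have hf : ContDiffAt ℝ 1 f (p, t) := by
    have hnorm := contDiffAt_norm_fst_sub hpq t
    exact ContDiffAt.div (by fun_prop) ((contDiff_timeWeight a b).contDiffAt.comp _ contDiffAt_snd)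
      hτ.ne'
  have htouch : IsLocalMax (fun z : E × ℝ => w z.1 z.2 i - f z) (p, t) := by
    have hself : w p t i - f (p, t) = w q s i := by
      simp only [f]
      rw [hf_self, mul_div_cancel_right₀ _ hτ.ne', sub_sub_cancel]
    filter_upwards [continuousAt_snd.eventually (isOpen_Ioo.mem_nhds ht)] with z hz
    rw [hself, sub_le_comm, le_div_iff₀ (timeWeight_pos hz)]
    have hz' := hmax.doubling_le i z.1 z.2 (Ioo_subset_Icc_self hz) q s hmax.right_mem
    have hd := mul_le_mul_of_nonneg_left (dist_mk_le_norm_sub (Λ := Λ) z.1 q) hK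
    rw [doubling] at hz'
    linarith
  have hderiv : HasDerivAt (fun r => f (p, r))
      ((2 * (t - s) / ε - (w p t i - w q s i) * (a + b - 2 * t)) / timeWeight a b t) t := by
    have hnum : HasDerivAt (fun r => Φ + K * ‖p - q‖ + (r - s) ^ 2 / ε) (2 * (t - s) / ε) t := by
      simpa using ((((hasDerivAt_id t).sub_const s).pow 2).div_const ε).const_add
        (Φ + K * ‖p - q‖)
    refine (hnum.div (hasDerivAt_timeWeight a b t) hτ.ne').congr_deriv ?_
    rw [hf_self]
    field_simp
  have hgrad : HasGradientAt (fun z => f (z, t))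
      ((K / timeWeight a b t) • NormedSpace.normalize (p - q)) p := by
    refine hasGradientAt_comp_of_hasDerivAt (f := fun z => ‖z - q‖)
      (g := fun r => (Φ + K * r + (t - s) ^ 2 / ε) / timeWeight a b t) ?_
      (hasGradientAt_norm_sub hpq)
    simpa using ((((hasDerivAt_id ‖p - q‖).const_mul K).const_add Φ).add_const
      ((t - s) ^ 2 / ε)).div_const (timeWeight a b t)
  exact hw.add_le_zero ht hf htouch hderiv hgrad

theorem IsDoublingMax.zero_le_add [CompleteSpace E] {F : E ⧸ Λ → ℝ → E → ℝ}
    (hmax : IsDoublingMax w a b K ε i p t q s) (hK : 0 ≤ K) (ht : t ∈ Ioo a b) (hs : s ∈ Ioo a b)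
    (hpq : p ≠ q) (hdist : ‖p - q‖ = dist (p : E ⧸ Λ) q)
    (hw : IsSupersolutionOn F (Ioo a b) fun x t => w x t i) :
    0 ≤ 2 * (t - s) / ε / timeWeight a b t
      + F q s ((K / timeWeight a b t) • NormedSpace.normalize (p - q)) := by
  let f : E × ℝ → ℝ := fun z => (-K * ‖z.1 - p‖ - (t - z.2) ^ 2 / ε) / timeWeight a b t
  have hτ := timeWeight_pos ht
  have hf : ContDiffAt ℝ 1 f (q, s) := by
    have hnorm := contDiffAt_norm_fst_sub hpq.symm s
    exact ContDiffAt.div_const (by fun_prop) _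
  have htouch : IsLocalMin (fun z : E × ℝ => w z.1 z.2 i - f z) (q, s) := by
    filter_upwards [continuousAt_snd.eventually (isOpen_Ioo.mem_nhds hs)] with z hz
    have hz' := hmax.doubling_le i p t hmax.left_mem z.1 z.2 (Ioo_subset_Icc_self hz)
    have hd := mul_le_mul_of_nonneg_left (dist_mk_le_norm_sub (Λ := Λ) p z.1) hK
    rw [norm_sub_rev p] at hd
    refine le_of_mul_le_mul_left ?_ hτ
    simp only [doubling, f, ← hdist, mul_sub, mul_div_cancel₀ _ hτ.ne', norm_sub_rev p q]
      at hz' ⊢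
    linarith
  have hderiv : HasDerivAt (fun r => f (q, r)) (2 * (t - s) / ε / timeWeight a b t) s := by
    refine ((((((hasDerivAt_id s).const_sub t).pow 2).div_const ε).const_sub
      (-K * ‖q - p‖)).div_const (timeWeight a b t)).congr_deriv ?_
    simp only [id]
    ring
  have hgrad : HasGradientAt (fun z => f (z, s))
      ((K / timeWeight a b t) • NormedSpace.normalize (p - q)) q := by
    have h := hasGradientAt_comp_of_hasDerivAt (f := fun z => ‖z - p‖)
      (g := fun r => (-K * r - (t - s) ^ 2 / ε) / timeWeight a b t)
      ((((hasDerivAt_id ‖q - p‖).const_mul (-K)).sub_const _).div_const _)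
      (hasGradientAt_norm_sub hpq.symm)
    convert h using 1
    rw [← neg_sub q p, NormedSpace.normalize_neg, mul_one, smul_neg, neg_div, neg_smul]
  exact hw.zero_le_add hs hf htouch hderiv hgrad

theorem IsDoublingMax.exists_sub_le [ProperSpace E] [IsClosed (Λ : Set E)]
    {F : E ⧸ Λ → ℝ → E → ℝ} {x y : E ⧸ Λ}
    (hmax : IsDoublingMax w a b K ε i x t y s) (hK : 0 ≤ K) (ht : t ∈ Ioo a b) (hs : s ∈ Ioo a b)
    (hxy : x ≠ y) (hsub : IsSubsolutionOn F (Ioo a b) fun x t => w x t i)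
    (hsuper : IsSupersolutionOn F (Ioo a b) fun x t => w x t i) :
    ∃ ξ : E, ‖ξ‖ = K / timeWeight a b t ∧
      F x t ξ - F y s ξ ≤ (w x t i - w y s i) * (a + b - 2 * t) / timeWeight a b t := by
  obtain ⟨q, rfl⟩ := QuotientAddGroup.mk_surjective y
  obtain ⟨p, rfl, hdist⟩ := exists_mk_eq_norm_sub_eq_dist x q
  have hpq : p ≠ q := fun h => hxy (h ▸ rfl)
  have h₁ := hmax.add_le_zero hK ht hpq hdist hsub
  have h₂ := hmax.zero_le_add hK ht hs hpq hdist hsuper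
  refine ⟨(K / timeWeight a b t) • NormedSpace.normalize (p - q), ?_, ?_⟩
  · rw [norm_smul, NormedSpace.norm_normalize (sub_ne_zero.2 hpq), mul_one,
      Real.norm_of_nonneg (div_nonneg hK (timeWeight_pos ht).le)]
  · rw [sub_div] at h₁
    linarith

/- At a doubling maximum the weight `τ` contributes `D τ'(t) / τ(t) ≤ (b - a) D / τ(t)` to the
difference of the two equations, and `‖ξ‖ = K / τ(t)` with `K ≥ 1`: hence the lower bound that
`hgap` demands of the gain. -/
theorem exists_timeWeight_mul_sub_le [Fintype ι] [ProperSpace E] [IsClosed (Λ : Set E)]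
    [CompactSpace (E ⧸ Λ)] {F : ι → E ⧸ Λ → ℝ → E → ℝ}
    (hw : ContinuousOn (fun z : (E ⧸ Λ) × ℝ => w z.1 z.2) (univ ×ˢ Icc a b))
    (hsub : ∀ i, IsSubsolutionOn (F i) (Ioo a b) fun x t => w x t i)
    (hsuper : ∀ i, IsSupersolutionOn (F i) (Ioo a b) fun x t => w x t i) {B : ℝ}
    (hgap : ∀ i x y, ∀ t ∈ Ioo a b, ∀ s ∈ Ioo a b, ∀ ξ, B ≤ ‖ξ‖ → 0 < w x t i - w y s i →
      ‖ξ‖ * dist x y ≤ w x t i - w y s i → ‖w x t - w y s‖ ≤ 3 * (w x t i - w y s i) →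
      (b - a) * ‖ξ‖ * (w x t i - w y s i) < F i x t ξ - F i y s ξ) :
    ∃ K ≥ 0, ∀ i x y, ∀ t ∈ Icc a b,
      timeWeight a b t * (w x t i - w y t i) ≤ K * dist x y := by
  let K := max 1 (|B| * (b - a) ^ 2)
  have hK1 : 1 ≤ K := le_max_left _ _
  have hK : 0 ≤ K := zero_le_one.trans hK1
  refine ⟨K, hK, fun i x y t ht => le_of_not_gt fun hlt => ?_⟩
  obtain ⟨ε, hε, i, x, t, y, s, hmax, hpos, hs, hxy, hnorm⟩ :=
    exists_isDoublingMax_of_lt hw hK ht hlt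
  have ht := mem_Ioo_of_doubling_pos hK hε.le hmax.left_mem hpos
  have hτ := timeWeight_pos ht
  have hD := sub_pos_of_doubling_pos hK hε.le hmax.left_mem hpos
  obtain ⟨ξ, hξ, hle⟩ := hmax.exists_sub_le hK ht hs hxy (hsub i) (hsuper i)
  have hB : B ≤ ‖ξ‖ := by
    rw [hξ, le_div_iff₀ hτ]
    calc B * timeWeight a b t ≤ |B| * (b - a) ^ 2 :=
          mul_le_mul (le_abs_self B) (timeWeight_le_sq hmax.left_mem) hτ.le (abs_nonneg B)
      _ ≤ K := le_max_right _ _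
  have hξdist : ‖ξ‖ * dist x y ≤ w x t i - w y s i := by
    rw [hξ, div_mul_eq_mul_div, div_le_iff₀' hτ]
    have hpen : 0 ≤ (t - s) ^ 2 / ε := by positivity
    rw [doubling] at hpos
    linarith
  have htime : (w x t i - w y s i) * (a + b - 2 * t) / timeWeight a b t
      ≤ (b - a) * ‖ξ‖ * (w x t i - w y s i) := by
    rw [hξ, mul_div_assoc', div_mul_eq_mul_div, mul_comm]
    refine div_le_div_of_nonneg_right (mul_le_mul_of_nonneg_right ?_ hD.le) hτ.le
    exact (show a + b - 2 * t ≤ b - a by linarith [ht.1]).trans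
      (le_mul_of_one_le_right (sub_nonneg.2 (ht.1.trans ht.2).le) hK1)
  exact (hle.trans htime).not_gt (hgap i x y t ht s hs ξ hB hD hξdist hnorm)

end DoublingViscosity

/-! ### Lipschitz estimate in space -/

section Gap

variable {X E : Type*} [PseudoMetricSpace X] [NormedAddCommGroup E] [NormedSpace ℝ E]

/-- Kinetic parts `h(x, p)` which are convex in `p`, pinched between `a ‖p‖ ^ 2` and `A ‖p‖ ^ 2`,
and Lipschitz in `x` with constant `A ‖p‖ ^ 2`. -/
structure IsQuadraticHamiltonian (a A : ℝ) (h : X → E → ℝ) : Prop where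
  pos : 0 < a
  convexOn : ∀ x, ConvexOn ℝ univ (h x)
  mul_sq_le : ∀ x p, a * ‖p‖ ^ 2 ≤ h x p
  le_mul_sq : ∀ x p, h x p ≤ A * ‖p‖ ^ 2
  abs_sub_le : ∀ x y p, |h x p - h y p| ≤ A * ‖p‖ ^ 2 * dist x y

variable {h : X → E → ℝ} {a A L T V r s P P' : ℝ} {x y : X} {p : E}

theorem IsQuadraticHamiltonian.upper_pos (hh : IsQuadraticHamiltonian a A h) (x : X) (hp : p ≠ 0) :
    0 < A := by
  have hn : 0 < ‖p‖ ^ 2 := by positivity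
  exact hh.pos.trans_le
    (le_of_mul_le_mul_right ((hh.mul_sq_le x p).trans (hh.le_mul_sq x p)) hn)

theorem IsQuadraticHamiltonian.le_apply_smul_div_sub (hh : IsQuadraticHamiltonian a A h)
    (hr : 1 ≤ r) (hrs : r < s) (hs : s ≤ V) (hp : p ≠ 0)
    (hd : ‖p‖ * dist x y ≤ Real.log s - Real.log r) :
    (a ^ 2 / (4 * A) * ‖p‖ ^ 2 / V - A * V * ‖p‖) * (Real.log s - Real.log r)
      ≤ h x (s • p) / s - h y (r • p) / r := by
  have hA := hh.upper_pos x hp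
  have hr0 : 0 < r := one_pos.trans_le hr
  have hs0 : 0 < s := hr0.trans hrs
  have hV : 0 < V := hs0.trans_le hs
  set D := Real.log s - Real.log r
  have hscale := mul_sq_norm_le_apply_smul_div_sub (hh.convexOn x) hh.pos (hh.mul_sq_le x)
    (hh.le_mul_sq x) hr0 hrs p
  have hlog : D / V ≤ r * (s - r) / s :=
    div_le_div₀ (mul_nonneg hr0.le (sub_nonneg.2 hrs.le))
      (log_sub_log_le_mul_sub hr hs0 hrs.le) hs0 hs
  have hspace : (h y (r • p) - h x (r • p)) / r ≤ A * V * ‖p‖ * D := by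
    rw [div_le_iff₀ hr0]
    calc h y (r • p) - h x (r • p) ≤ A * ‖r • p‖ ^ 2 * dist x y := by
          rw [dist_comm]
          exact (le_abs_self _).trans (hh.abs_sub_le y x _)
      _ = A * r * ‖p‖ * (‖p‖ * dist x y) * r := by
          rw [norm_smul, Real.norm_of_nonneg hr0.le]
          ring
      _ ≤ A * V * ‖p‖ * D * r := by
          gcongr
          exact hrs.le.trans hs
  have hgain := mul_le_mul_of_nonneg_left hlog
    (show 0 ≤ a ^ 2 / (4 * A) * ‖p‖ ^ 2 by positivity)
  rw [sub_div] at hspace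
  calc (a ^ 2 / (4 * A) * ‖p‖ ^ 2 / V - A * V * ‖p‖) * D
      = a ^ 2 / (4 * A) * ‖p‖ ^ 2 * (D / V) - A * V * ‖p‖ * D := by ring
    _ ≤ h x (s • p) / s - h y (r • p) / r := by linarith

theorem div_sub_div_le_of_abs_sub_le {δ : ℝ} (hr : 1 ≤ r) (hrs : r ≤ s) (hPP : |P - P'| ≤ δ)
    (hP : |P'| ≤ L) : P' / r - P / s ≤ δ + L * (s - r) := by
  have hr0 : 0 < r := one_pos.trans_le hr
  have hs : 1 ≤ s := hr.trans hrs
  have hs0 : 0 < s := one_pos.trans_le hs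
  have hδ : (P' - P) / s ≤ δ := by
    rw [abs_sub_comm] at hPP
    exact (div_le_iff₀ hs0).2 (((le_abs_self _).trans hPP).trans
      (le_mul_of_one_le_right ((abs_nonneg _).trans hPP) hs))
  have hL : P' * ((s - r) / (r * s)) ≤ L * (s - r) := by
    have hsr := sub_nonneg.2 hrs
    exact mul_le_mul ((le_abs_self _).trans hP)
      (div_le_self hsr (one_le_mul_of_one_le_of_one_le hr hs)) (by positivity)
      ((abs_nonneg _).trans hP)
  calc P' / r - P / s = (P' - P) / s + P' * ((s - r) / (r * s)) := by
        field_simp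
        ring
    _ ≤ δ + L * (s - r) := add_le_add hδ hL

theorem IsQuadraticHamiltonian.lt_apply_smul_add_div_sub (hh : IsQuadraticHamiltonian a A h)
    (hr : 1 ≤ r) (hrs : r < s) (hs : s ≤ V) (hp : 1 ≤ ‖p‖)
    (hd : ‖p‖ * dist x y ≤ Real.log s - Real.log r)
    (hPP : |P - P'| ≤ L * (3 * V * (Real.log s - Real.log r))) (hP : |P'| ≤ L)
    (hT : V * (A * V + T + L * (4 * V)) / (a ^ 2 / (4 * A)) < ‖p‖) :
    T * ‖p‖ * (Real.log s - Real.log r) < (h x (s • p) + P) / s - (h y (r • p) + P') / r := by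
  have hp0 : p ≠ 0 := norm_pos_iff.1 (one_pos.trans_le hp)
  have hA := hh.upper_pos x hp0
  have ha := hh.pos
  have hr0 : 0 < r := one_pos.trans_le hr
  have hV : 0 < V := hr0.trans (hrs.trans_le hs)
  have hL : 0 ≤ L := (abs_nonneg _).trans hP
  have hkin := hh.le_apply_smul_div_sub hr hrs hs hp0 hd
  have hpot := div_sub_div_le_of_abs_sub_le hr hrs.le hPP hP
  have hsr := mul_le_mul_of_nonneg_left (sub_le_mul_log_sub_log hr0 hrs.le hs) hL
  have hD : 0 < Real.log s - Real.log r := sub_pos.2 (Real.log_lt_log hr0 hrs)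
  set D := Real.log s - Real.log r
  have hbig : (A * V + T + L * (4 * V)) * ‖p‖ < a ^ 2 / (4 * A) * ‖p‖ ^ 2 / V := by
    rw [div_lt_iff₀ (by positivity)] at hT
    rw [lt_div_iff₀ hV]
    calc (A * V + T + L * (4 * V)) * ‖p‖ * V = V * (A * V + T + L * (4 * V)) * ‖p‖ := by ring
      _ < ‖p‖ * (a ^ 2 / (4 * A)) * ‖p‖ :=
          mul_lt_mul_of_pos_right hT (one_pos.trans_le hp)
      _ = a ^ 2 / (4 * A) * ‖p‖ ^ 2 := by ring
  have hgain := mul_lt_mul_of_pos_right hbig hD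
  have hLp : L * (4 * V) * D ≤ L * (4 * V) * ‖p‖ * D :=
    mul_le_mul_of_nonneg_right (le_mul_of_one_le_right (by positivity) hp) hD.le
  rw [add_div, add_div]
  linarith

end Gap

section Bounds

variable {ι : Type*} [Fintype ι] {R : ℝ}

theorem exists_bound_lipschitz_on_closedBall {X : Type*} [PseudoMetricSpace X] [CompactSpace X]
    {P : ι → X → (ι → ℝ) → ℝ} (hP : ∀ i, LocallyLipschitz (uncurry (P i))) (R : ℝ) :
    ∃ L ≥ 0, ∀ i x u, ‖u‖ ≤ R → |P i x u| ≤ L ∧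
      ∀ y v, ‖v‖ ≤ R → |P i x u - P i y v| ≤ L * max (dist x y) ‖u - v‖ := by
  have hcpt : IsCompact (univ ×ˢ Metric.closedBall 0 R : Set (X × (ι → ℝ))) :=
    isCompact_univ.prod (isCompact_closedBall 0 R)
  choose K hK using fun i =>
    LocallyLipschitzOn.exists_lipschitzOnWith_of_compact hcpt (hP i).locallyLipschitzOn
  choose C hC using fun i => hcpt.exists_bound_of_continuousOn (hP i).continuous.continuousOn
  have hle : ∀ i, K i + |C i| ≤ ∑ j, (K j + |C j|) := fun i =>
    Finset.single_le_sum (f := fun j => K j + |C j|) (fun j _ => by positivity)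
      (Finset.mem_univ i)
  refine ⟨∑ j, (K j + |C j|), by positivity, fun i x u hu => ?_⟩
  have hmem : ∀ y v, ‖v‖ ≤ R → (y, v) ∈ (univ ×ˢ Metric.closedBall 0 R : Set (X × (ι → ℝ))) :=
    fun y v hv => ⟨trivial, mem_closedBall_zero_iff.2 hv⟩
  refine ⟨?_, fun y v hv => ?_⟩
  · exact (hC i _ (hmem x u hu)).trans ((le_abs_self _).trans
      ((le_add_of_nonneg_left (K i).2).trans (hle i)))
  · have hlip := (hK i).dist_le_mul _ (hmem x u hu) _ (hmem y v hv)
    rw [Prod.dist_eq, dist_eq_norm u, Real.dist_eq] at hlip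
    exact hlip.trans (mul_le_mul_of_nonneg_right
      ((le_add_of_nonneg_right (abs_nonneg _)).trans (hle i)) (le_max_of_le_left dist_nonneg))

theorem exists_abs_add_le_on_closedBall {X E : Type*} [PseudoMetricSpace X] [CompactSpace X]
    [NormedAddCommGroup E] [NormedSpace ℝ E] {a A : ℝ} {h : ι → X → E → ℝ}
    {P : ι → X → (ι → ℝ) → ℝ} (hh : ∀ i, IsQuadraticHamiltonian a A (h i))
    (hP : ∀ i, LocallyLipschitz (uncurry (P i))) (R : ℝ) :
    ∃ M, ∀ i x p c, ‖p‖ ≤ R → ‖c‖ ≤ R → |h i x p + P i x c| ≤ M := by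
  obtain ⟨L, -, hL⟩ := exists_bound_lipschitz_on_closedBall hP R
  refine ⟨|A| * R ^ 2 + L, fun i x p c hp hc =>
    (abs_add_le _ _).trans (add_le_add ?_ (hL i x c hc).1)⟩
  have hnonneg : 0 ≤ h i x p :=
    (mul_nonneg (hh i).pos.le (sq_nonneg _)).trans ((hh i).mul_sq_le x p)
  calc |h i x p| = h i x p := abs_of_nonneg hnonneg
    _ ≤ A * ‖p‖ ^ 2 := (hh i).le_mul_sq x p
    _ ≤ |A| * R ^ 2 := by
        gcongr
        exact le_abs_self A

theorem mem_Icc_one_add_of_norm_le {c : ι → ℝ} (hc : ‖c‖ ≤ R) (i : ι) :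
    c i + (R + 1) ∈ Icc 1 (2 * R + 1) := by
  have h := abs_le.1 ((norm_le_pi_norm c i).trans hc)
  exact ⟨by linarith [h.1], by linarith [h.2]⟩

theorem norm_sub_le_mul_norm_log_sub_log {c d : ι → ℝ} (hc : ‖c‖ ≤ R) (hd : ‖d‖ ≤ R) :
    ‖c - d‖ ≤ (2 * R + 1) *
      ‖fun i => Real.log (c i + (R + 1)) - Real.log (d i + (R + 1))‖ := by
  have hR := (norm_nonneg c).trans hc
  refine (pi_norm_le_iff_of_nonneg (by positivity)).2 fun i => ?_
  have hci := mem_Icc_one_add_of_norm_le hc i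
  have hdi := mem_Icc_one_add_of_norm_le hd i
  calc ‖(c - d) i‖ = |c i + (R + 1) - (d i + (R + 1))| := by
        rw [add_sub_add_right_eq_sub, Pi.sub_apply, Real.norm_eq_abs]
    _ ≤ (2 * R + 1) * |Real.log (c i + (R + 1)) - Real.log (d i + (R + 1))| :=
        abs_sub_le_mul_abs_log_sub_log (one_pos.trans_le hdi.1) (one_pos.trans_le hci.1) hdi.2 hci.2
    _ ≤ _ := mul_le_mul_of_nonneg_left
        (norm_le_pi_norm (fun i => Real.log (c i + (R + 1)) - Real.log (d i + (R + 1))) i)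
        (by positivity)

end Bounds

section Space

variable {E ι : Type*} [NormedAddCommGroup E] [InnerProductSpace ℝ E] [ProperSpace E] [Fintype ι]
  {Λ : AddSubgroup E} {h : ι → E ⧸ Λ → E → ℝ} {P : ι → E ⧸ Λ → (ι → ℝ) → ℝ}
  {u : E ⧸ Λ → ℝ → ι → ℝ} {a A α β δ R : ℝ} {I : Set ℝ}

theorem IsViscositySolutionOn.exists_timeWeight_mul_log_sub_le [IsClosed (Λ : Set E)]
    [CompactSpace (E ⧸ Λ)] (hh : ∀ i, IsQuadraticHamiltonian a A (h i))
    (hP : ∀ i, LocallyLipschitz (uncurry (P i)))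
    (hu : IsViscositySolutionOn (fun i x p c => h i x p + P i x c) I u) (hI : Icc α β ⊆ I)
    (hR : ∀ x, ∀ t ∈ Icc α β, ‖u x t‖ ≤ R) :
    ∃ K ≥ 0, ∀ i x y, ∀ t ∈ Icc α β, timeWeight α β t *
      (Real.log (u x t i + (R + 1)) - Real.log (u y t i + (R + 1))) ≤ K * dist x y := by
  obtain ⟨L, hL0, hL⟩ := exists_bound_lipschitz_on_closedBall hP R
  have hmem : ∀ i x, ∀ t ∈ Icc α β, u x t i + (R + 1) ∈ Icc 1 (2 * R + 1) :=
    fun i x t ht => mem_Icc_one_add_of_norm_le (hR x t ht) i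
  have hpos : ∀ i x, ∀ t ∈ Icc α β, 0 < u x t i + (R + 1) :=
    fun i x t ht => one_pos.trans_le (hmem i x t ht).1
  have hIoo : Ioo α β ⊆ I := Ioo_subset_Icc_self.trans hI
  refine exists_timeWeight_mul_sub_le
    (w := fun x t i => Real.log (u x t i + (R + 1))) (continuousOn_pi.2 fun i => ?_)
    (fun i => (((hu.isSubsolutionOn i).mono hIoo).add_const (R + 1)).log isOpen_Ioo
      fun x t ht => hpos i x t (Ioo_subset_Icc_self ht))
    (fun i => (((hu.isSupersolutionOn i).mono hIoo).add_const (R + 1)).log isOpen_Ioo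
      fun x t ht => hpos i x t (Ioo_subset_Icc_self ht))
    (B := max 1 ((2 * R + 1) * (A * (2 * R + 1) + (β - α) + L * (4 * (2 * R + 1)))
      / (a ^ 2 / (4 * A)) + 1))
    fun i x y t ht s hs ξ hB hD hξ hw => ?_
  · exact (((continuousOn_pi.1 hu.continuousOn i).mono (prod_mono_right hI)).add_const _).log
      fun z hz => (hpos i z.1 z.2 hz.2).ne'
  have ht := Ioo_subset_Icc_self ht
  have hs := Ioo_subset_Icc_self hs
  have hV : 1 ≤ 2 * R + 1 := (hmem i x t ht).1.trans (hmem i x t ht).2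
  have hξ1 : 1 ≤ ‖ξ‖ := (le_max_left _ _).trans hB
  have hPP : |P i x (u x t) - P i y (u y s)| ≤ L * (3 * (2 * R + 1) *
      (Real.log (u x t i + (R + 1)) - Real.log (u y s i + (R + 1)))) := by
    refine ((hL i x _ (hR x t ht)).2 y _ (hR y s hs)).trans
      (mul_le_mul_of_nonneg_left (max_le ?_ ?_) hL0)
    · calc dist x y ≤ ‖ξ‖ * dist x y := le_mul_of_one_le_left dist_nonneg hξ1
        _ ≤ _ := hξ
        _ ≤ _ := le_mul_of_one_le_left hD.le (by linarith)
    · refine (norm_sub_le_mul_norm_log_sub_log (hR x t ht) (hR y s hs)).trans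
        ((mul_le_mul_of_nonneg_left hw (by linarith)).trans_eq ?_)
      ring
  exact (hh i).lt_apply_smul_add_div_sub (hmem i y s hs).1
    ((Real.log_lt_log_iff (hpos i y s hs) (hpos i x t ht)).1 (sub_pos.1 hD)) (hmem i x t ht).2
    hξ1 hξ hPP (hL i y _ (hR y s hs)).1 ((lt_add_one _).trans_le ((le_max_right _ _).trans hB))

theorem IsViscositySolutionOn.exists_timeWeight_mul_norm_sub_le [IsClosed (Λ : Set E)]
    [CompactSpace (E ⧸ Λ)] (hh : ∀ i, IsQuadraticHamiltonian a A (h i))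
    (hP : ∀ i, LocallyLipschitz (uncurry (P i)))
    (hu : IsViscositySolutionOn (fun i x p c => h i x p + P i x c) I u) (hI : Icc α β ⊆ I) :
    ∃ K ≥ 0, ∀ x y, ∀ t ∈ Icc α β, timeWeight α β t * ‖u x t - u y t‖ ≤ K * dist x y := by
  obtain ⟨R, hR⟩ := (isCompact_univ.prod isCompact_Icc).exists_bound_of_continuousOn
    (hu.continuousOn.mono (prod_mono_right hI))
  replace hR : ∀ x, ∀ t ∈ Icc α β, ‖u x t‖ ≤ |R| :=
    fun x t ht => (hR (x, t) ⟨trivial, ht⟩).trans (le_abs_self R)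
  obtain ⟨K, hK, hlog⟩ := hu.exists_timeWeight_mul_log_sub_le hh hP hI hR
  refine ⟨(2 * |R| + 1) * K, by positivity, fun x y t ht => ?_⟩
  have hτ := timeWeight_nonneg ht
  set d : ι → ℝ := fun i => Real.log (u x t i + (|R| + 1)) - Real.log (u y t i + (|R| + 1))
  have hτd : timeWeight α β t * ‖d‖ ≤ K * dist x y := by
    rw [← Real.norm_of_nonneg hτ, ← norm_smul]
    refine (pi_norm_le_iff_of_nonneg (by positivity)).2 fun i => abs_le'.2 ⟨hlog i x y t ht, ?_⟩
    rw [dist_comm]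
    refine Eq.trans_le ?_ (hlog i y x t ht)
    rw [Pi.smul_apply, smul_eq_mul, ← mul_neg, neg_sub]
  calc timeWeight α β t * ‖u x t - u y t‖
      ≤ timeWeight α β t * ((2 * |R| + 1) * ‖d‖) := mul_le_mul_of_nonneg_left
        (norm_sub_le_mul_norm_log_sub_log (hR x t ht) (hR y t ht)) hτ
    _ = (2 * |R| + 1) * (timeWeight α β t * ‖d‖) := by ring
    _ ≤ (2 * |R| + 1) * (K * dist x y) := mul_le_mul_of_nonneg_left hτd (by positivity)
    _ = (2 * |R| + 1) * K * dist x y := by ring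

theorem IsViscositySolutionOn.exists_lipschitzWith_space [IsClosed (Λ : Set E)]
    [CompactSpace (E ⧸ Λ)] (hh : ∀ i, IsQuadraticHamiltonian a A (h i))
    (hP : ∀ i, LocallyLipschitz (uncurry (P i)))
    (hu : IsViscositySolutionOn (fun i x p c => h i x p + P i x c) I u) (hI : Icc α β ⊆ I)
    (hδ : 0 < δ) : ∃ κ : ℝ≥0, ∀ t ∈ Icc (α + δ) (β - δ), LipschitzWith κ fun x => u x t := by
  obtain ⟨K, hK, hlip⟩ := hu.exists_timeWeight_mul_norm_sub_le hh hP hI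
  refine ⟨.mk (K / δ ^ 2) (by positivity), fun t ht => LipschitzWith.of_dist_le_mul fun x y => ?_⟩
  have hα : δ ≤ t - α := le_sub_iff_add_le'.2 ht.1
  have hα₀ := hδ.le.trans hα
  have hβ : δ ≤ β - t := le_sub_comm.1 ht.2
  rw [dist_eq_norm, NNReal.coe_mk, div_mul_eq_mul_div, le_div_iff₀' (by positivity), sq]
  calc δ * δ * ‖u x t - u y t‖ ≤ timeWeight α β t * ‖u x t - u y t‖ := by
        unfold timeWeight
        gcongr
    _ ≤ K * dist x y := hlip x y t ⟨by linarith, by linarith⟩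

end Space

/-! ### Lipschitz estimate in time -/

section Time

variable {E : Type*} [NormedAddCommGroup E] [InnerProductSpace ℝ E] {Λ : AddSubgroup E}

section Paraboloid

variable {F : E ⧸ Λ → ℝ → E → ℝ} {I : Set ℝ} {v : E ⧸ Λ → ℝ → ℝ} {κ C k s₀ s₁ t : ℝ}

theorem IsSubsolutionOn.add_apply_smul_sub_le_zero [CompleteSpace E] (hv : IsSubsolutionOn F I v)
    (ht : t ∈ I) {x y : E} (hy : ‖y - x‖ = dist (y : E ⧸ Λ) x) (hk : 0 ≤ k)
    (hmax : ∀ᶠ s in 𝓝 t, ∀ z : E ⧸ Λ,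
      v z s - (C * s + k * dist z x ^ 2) ≤ v y t - (C * t + k * dist (y : E ⧸ Λ) x ^ 2)) :
    C + F y t (k • (2 : ℝ) • (y - x)) ≤ 0 := by
  have hf : ContDiff ℝ 1 fun z : E × ℝ => C * z.2 + k * ‖z.1 - x‖ ^ 2 :=
    (contDiff_const.mul contDiff_snd).add
      (contDiff_const.mul ((contDiff_fst.sub contDiff_const).norm_sq ℝ))
  have hmax' : IsLocalMax (fun z : E × ℝ => v z.1 z.2 - (C * z.2 + k * ‖z.1 - x‖ ^ 2)) (y, t) := by
    filter_upwards [continuousAt_snd.eventually hmax] with z hz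
    rw [hy]
    refine le_trans ?_ (hz z.1)
    gcongr
    exact dist_mk_le_norm_sub z.1 x
  refine hv.add_le_zero ht hf.contDiffAt hmax' ?_ ?_
  · simpa using ((hasDerivAt_id t).const_mul C).add_const (k * ‖y - x‖ ^ 2)
  · exact hasGradientAt_comp_of_hasDerivAt (g := fun r => C * t + k * r)
      (by simpa using ((hasDerivAt_id _).const_mul k).const_add (C * t))
      (hasGradientAt_norm_sub_sq y x)

theorem mul_le_of_mul_sq_le_mul {r : ℝ} (hr : 0 ≤ r) (hκ : 0 ≤ κ) (h : k * r ^ 2 ≤ κ * r) :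
    k * r ≤ κ := by
  rcases hr.eq_or_lt with rfl | hpos
  · rwa [mul_zero]
  · exact le_of_mul_le_mul_right (by linarith) hpos

/- The function `v` is compared with `C * t + k * dist · x ^ 2`, where `k → ∞`: spatial Lipschitz
continuity keeps the gradient of the paraboloid at the touching point below `2 * κ`. -/
theorem IsSubsolutionOn.le_add_mul_sub [ProperSpace E] [IsClosed (Λ : Set E)]
    [CompactSpace (E ⧸ Λ)] (hv : IsSubsolutionOn F (Ioo s₀ s₁) v)
    (hc : ContinuousOn (fun z : (E ⧸ Λ) × ℝ => v z.1 z.2) (univ ×ˢ Icc s₀ s₁))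
    (hκ₀ : 0 ≤ κ) (hκ : ∀ x y, ∀ t ∈ Icc s₀ s₁, v x t - v y t ≤ κ * dist x y)
    (hF : ∀ x, ∀ t ∈ Ioo s₀ s₁, ∀ p, ‖p‖ ≤ 2 * κ → 0 < C + F x t p)
    (hs₁ : ∀ x y, v x s₁ - v y s₀ < C * (s₁ - s₀)) (x : E ⧸ Λ) (ht : t ∈ Icc s₀ s₁) :
    v x t ≤ v x s₀ + C * (t - s₀) := by
  refine le_of_forall_pos_le_add fun e he => ?_
  have hs₀ : s₀ ∈ Icc s₀ s₁ := ⟨le_rfl, ht.1.trans ht.2⟩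
  set k := κ ^ 2 / e + 1
  have hk : 0 < k := by positivity
  have hke : κ ^ 2 ≤ k * e := by
    rw [add_mul, div_mul_cancel₀ _ he.ne', one_mul]
    exact le_add_of_nonneg_right he.le
  obtain ⟨⟨y, τ⟩, ⟨-, hτ⟩, hmax⟩ := (isCompact_univ.prod isCompact_Icc).exists_isMaxOn
    ⟨(x, s₀), trivial, hs₀⟩ (hc.sub (g := fun z => C * z.2 + k * dist z.1 x ^ 2) (by fun_prop))
  replace hmax : ∀ z, ∀ s ∈ Icc s₀ s₁,
      v z s - (C * s + k * dist z x ^ 2) ≤ v y τ - (C * τ + k * dist y x ^ 2) :=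
    fun z s hs => hmax (mk_mem_prod trivial hs)
  have hcenter : ∀ s ∈ Icc s₀ s₁, v x s - C * s ≤ v y τ - (C * τ + k * dist y x ^ 2) :=
    fun s hs => by simpa using hmax x s hs
  have hsq : 0 ≤ k * dist y x ^ 2 := by positivity
  have hκτ := hκ y x τ hτ
  have hslope : k * dist y x ≤ κ :=
    mul_le_of_mul_sq_le_mul dist_nonneg hκ₀ (by linarith [hcenter τ hτ])
  rcases hτ.1.eq_or_lt with rfl | hlt
  · have hd : κ * dist y x ≤ e := by
      refine le_of_mul_le_mul_left ?_ hk
      calc k * (κ * dist y x) = κ * (k * dist y x) := by ring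
        _ ≤ κ * κ := mul_le_mul_of_nonneg_left hslope hκ₀
        _ ≤ k * e := by rwa [← sq]
    linarith [hcenter t ht]
  rcases hτ.2.eq_or_lt with rfl | hgt
  · linarith [hcenter s₀ hs₀, hs₁ y x]
  obtain ⟨a, rfl⟩ := QuotientAddGroup.mk_surjective x
  obtain ⟨b, rfl, hb⟩ := exists_mk_eq_norm_sub_eq_dist y a
  refine absurd (hv.add_apply_smul_sub_le_zero ⟨hlt, hgt⟩ hb hk.le ?_)
    (hF _ τ ⟨hlt, hgt⟩ _ ?_).not_ge
  · filter_upwards [Icc_mem_nhds hlt hgt] with s hs z using hmax z s hs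
  · rw [norm_smul, norm_smul, hb, Real.norm_of_nonneg hk.le, Real.norm_two]
    linarith

theorem IsSubsolutionOn.abs_sub_le_mul_sub [ProperSpace E] [IsClosed (Λ : Set E)]
    [CompactSpace (E ⧸ Λ)] (hv : IsSubsolutionOn F (Ioo s₀ s₁) v)
    (hv' : IsSupersolutionOn F (Ioo s₀ s₁) v)
    (hc : ContinuousOn (fun z : (E ⧸ Λ) × ℝ => v z.1 z.2) (univ ×ˢ Icc s₀ s₁))
    (hκ₀ : 0 ≤ κ) (hκ : ∀ x y, ∀ t ∈ Icc s₀ s₁, |v x t - v y t| ≤ κ * dist x y)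
    (hF : ∀ x, ∀ t ∈ Ioo s₀ s₁, ∀ p, ‖p‖ ≤ 2 * κ → |F x t p| < C)
    (hs₁ : ∀ x y, |v x s₁ - v y s₀| < C * (s₁ - s₀)) (x : E ⧸ Λ) (ht : t ∈ Icc s₀ s₁) :
    |v x t - v x s₀| ≤ C * (t - s₀) := by
  have hup := hv.le_add_mul_sub hc hκ₀ (fun x y t ht => (abs_le.1 (hκ x y t ht)).2)
    (fun x t ht p hp => neg_lt_iff_pos_add'.1 (abs_lt.1 (hF x t ht p hp)).1)
    (fun x y => (abs_lt.1 (hs₁ x y)).2) x ht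
  have hlow := hv'.neg.le_add_mul_sub (C := C) hc.neg hκ₀
    (fun x y t ht => by linarith [(abs_le.1 (hκ x y t ht)).1])
    (fun x t ht p hp => by
      linarith [(abs_lt.1 (hF x t ht (-p) ((norm_neg p).trans_le hp))).2])
    (fun x y => by linarith [(abs_lt.1 (hs₁ x y)).1]) x ht
  exact abs_le.2 ⟨by linarith, by linarith⟩

end Paraboloid

variable {ι : Type*} [Fintype ι] {H : ι → E ⧸ Λ → E → (ι → ℝ) → ℝ} {u : E ⧸ Λ → ℝ → ι → ℝ}
  {I : Set ℝ} {α β γ R C s t : ℝ} {κ : ℝ≥0}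

theorem IsViscositySolutionOn.norm_sub_le_mul_sub [ProperSpace E] [IsClosed (Λ : Set E)]
    [CompactSpace (E ⧸ Λ)] (hu : IsViscositySolutionOn H I u) (hI : Icc s β ⊆ I)
    (hκ : ∀ r ∈ Icc s β, LipschitzWith κ fun x => u x r)
    (hR : ∀ x, ∀ r ∈ Icc s β, ‖u x r‖ ≤ R)
    (hH : ∀ i x p c, ‖p‖ ≤ 2 * κ → ‖c‖ ≤ R → |H i x p c| < C)
    (hC : R + R < C * (β - s)) (x : E ⧸ Λ) (ht : t ∈ Icc s β) :
    ‖u x t - u x s‖ ≤ C * (t - s) := by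
  have hβ : s ≤ β := ht.1.trans ht.2
  have hIoo : Ioo s β ⊆ I := Ioo_subset_Icc_self.trans hI
  have hC₀ : 0 ≤ C := by
    have hR₀ := (norm_nonneg _).trans (hR x t ht)
    by_contra! hneg
    nlinarith
  refine (pi_norm_le_iff_of_nonneg (mul_nonneg hC₀ (sub_nonneg.2 ht.1))).2 fun i => ?_
  refine ((hu.isSubsolutionOn i).mono hIoo).abs_sub_le_mul_sub
    ((hu.isSupersolutionOn i).mono hIoo)
    ((continuousOn_pi.1 hu.continuousOn i).mono (prod_mono_right hI)) κ.2
    (fun y z r hr => ?_) (fun y r hr p hp => hH i y p _ hp (hR y r (Ioo_subset_Icc_self hr)))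
    (fun y z => ?_) x ht
  · exact (dist_le_pi_dist (u y r) (u z r) i).trans ((hκ r hr).dist_le_mul y z)
  · calc |u y β i - u z s i| ≤ ‖u y β - u z s‖ := norm_le_pi_norm (u y β - u z s) i
      _ ≤ R + R := norm_sub_le_of_le (hR y β ⟨hβ, le_rfl⟩) (hR z s ⟨le_rfl, hβ⟩)
      _ < C * (β - s) := hC

theorem IsViscositySolutionOn.exists_lipschitzOnWith_time [ProperSpace E] [IsClosed (Λ : Set E)]
    [CompactSpace (E ⧸ Λ)] (hu : IsViscositySolutionOn H I u)
    (hH : ∀ r, ∃ M, ∀ i x p c, ‖p‖ ≤ r → ‖c‖ ≤ r → |H i x p c| ≤ M) (hI : Icc α β ⊆ I)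
    (hγ : γ < β) (hκ : ∀ t ∈ Icc α β, LipschitzWith κ fun x => u x t) :
    ∃ C : ℝ≥0, ∀ x, LipschitzOnWith C (u x) (Icc α γ) := by
  obtain ⟨R, hR⟩ := (isCompact_univ.prod isCompact_Icc).exists_bound_of_continuousOn
    (hu.continuousOn.mono (prod_mono_right hI))
  obtain ⟨M, hM⟩ := hH (max R (2 * κ))
  obtain ⟨C, hC, hMC, hRC⟩ : ∃ C ≥ 0, M < C ∧ R + R < C * (β - γ) := by
    have hlarge := (tendsto_id.atTop_mul_const (sub_pos.2 hγ)).eventually_gt_atTop (R + R)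
    exact ((eventually_ge_atTop 0).and ((eventually_gt_atTop M).and hlarge)).exists
  have hle : ∀ x, ∀ s ∈ Icc α γ, ∀ t ∈ Icc s γ, dist (u x t) (u x s) ≤ C * dist t s := by
    intro x s hs t ht
    have hsβ : Icc s β ⊆ Icc α β := Icc_subset_Icc_left hs.1
    rw [dist_eq_norm, Real.dist_eq, abs_of_nonneg (sub_nonneg.2 ht.1)]
    exact hu.norm_sub_le_mul_sub (hsβ.trans hI) (fun r hr => hκ r (hsβ hr))
      (fun y r hr => hR (y, r) ⟨trivial, hsβ hr⟩)
      (fun i y p c hp hc => (hM i y p c (hp.trans (le_max_right _ _))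
        (hc.trans (le_max_left _ _))).trans_lt hMC)
      (hRC.trans_le (mul_le_mul_of_nonneg_left (sub_le_sub_left hs.2 β) hC)) x
      ⟨ht.1, ht.2.trans hγ.le⟩
  refine ⟨.mk C hC, fun x => LipschitzOnWith.of_dist_le_mul fun s hs t ht => ?_⟩
  rcases le_total s t with hst | hts
  · rw [dist_comm, dist_comm s]
    exact hle x s hs t ⟨hst, ht.2⟩
  · exact hle x t ht s ⟨hts, hs.2⟩

end Time

/-! ### Hamiltonians on the torus -/

section Model

variable {E : Type*} [NormedAddCommGroup E] [InnerProductSpace ℝ E] {Λ : AddSubgroup E}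

theorem abs_sub_le_mul_dist_of_norm_gradient_le [ProperSpace E] [IsClosed (Λ : Set E)]
    {f : E ⧸ Λ → ℝ} {C : ℝ} (hf : Differentiable ℝ fun z : E => f z)
    (hC : ∀ y : E, ‖gradient (fun z : E => f z) y‖ ≤ C) (x y : E ⧸ Λ) :
    |f x - f y| ≤ C * dist x y := by
  obtain ⟨b, rfl⟩ := QuotientAddGroup.mk_surjective y
  obtain ⟨a, rfl, hab⟩ := exists_mk_eq_norm_sub_eq_dist x b
  rw [← hab]
  refine Convex.norm_image_sub_le_of_norm_fderiv_le (𝕜 := ℝ) (f := fun z : E => f z)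
    (fun z _ => hf z) (fun z _ => ?_) convex_univ (mem_univ b) (mem_univ a)
  rw [← toDual_gradient, LinearIsometryEquiv.norm_map]
  exact hC z

variable {N m : ℕ} {H : Hamiltonians N m} {φ : Torus N → Fin m → ℝ} {u : Torus N → ℝ → Fin m → ℝ}

theorem StandingAssumptions.exists_isQuadraticHamiltonian (hH : StandingAssumptions H)
    (hA : ModelStructure H) :
    ∃ (h : Fin m → Torus N → Euc N → ℝ) (P : Fin m → Torus N → (Fin m → ℝ) → ℝ) (a A : ℝ),
      (∀ i, IsQuadraticHamiltonian a A (h i)) ∧ (∀ i, LocallyLipschitz (uncurry (P i))) ∧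
        H = fun i x p c => h i x p + P i x c := by
  obtain ⟨h, P, a, A, ha, -, -, hHP, hquad, hgrad⟩ := hA
  have hzero : ∀ i x, h i x 0 = 0 := fun i x => by
    have h₀ := hquad i x 0
    simp only [norm_zero, ne_eq, OfNat.ofNat_ne_zero, not_false_eq_true, zero_pow, mul_zero] at h₀
    exact le_antisymm h₀.2 h₀.1
  have hPH : ∀ i x c, P i x c = H i x 0 c := fun i x c => by rw [hHP, hzero, zero_add]
  have hhH : ∀ i x p, h i x p = H i x p 0 - P i x 0 := fun i x p => by
    rw [hHP, add_sub_cancel_right]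
  have hHdiff : ∀ i p, Differentiable ℝ fun z : Euc N => H i (proj z) p 0 := fun i p =>
    ((hH.contDiff i).differentiable two_ne_zero).comp
      (f := fun z : Euc N => (z, p, (0 : Fin m → ℝ))) (by fun_prop)
  refine ⟨h, P, a, A, fun i => ⟨ha, fun x => ?_, fun x p => (hquad i x p).1,
    fun x p => (hquad i x p).2, fun x y p => ?_⟩, fun i => locallyLipschitz_of_comp_mk ?_, ?_⟩
  · simp only [funext (hhH i x), sub_eq_add_neg]
    exact (hH.strictConvex i x 0).convexOn.add_const _
  · refine abs_sub_le_mul_dist_of_norm_gradient_le (f := fun z => h i z p) ?_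
      (fun z => hgrad i z p) x y
    simp only [hhH, hPH]
    exact (hHdiff i p).sub (hHdiff i 0)
  · have hP : ContDiff ℝ 1 fun z : Euc N × (Fin m → ℝ) => H i (proj z.1) 0 z.2 :=
      ((hH.contDiff i).of_le one_le_two).comp
        (f := fun z : Euc N × (Fin m → ℝ) => (z.1, (0 : Euc N), z.2)) (by fun_prop)
    simp only [uncurry, hPH]
    exact hP.locallyLipschitz
  · funext i x p c
    exact hHP i x p c

theorem IsViscositySolution.isViscositySolutionOn (hu : IsViscositySolution H φ u) :
    IsViscositySolutionOn H (Ioi 0) u where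
  continuousOn := hu.1.continuousOn.mono (prod_mono_right Ioi_subset_Ici_self)
  isSubsolutionOn i y t := hu.1.sub i y t
  isSupersolutionOn i y t := hu.2.super i y t

theorem isLocallyLipschitz_of_locallyLipschitzOn
    (hu : LocallyLipschitzOn (univ ×ˢ Ioi 0) (uncurry u)) : IsLocallyLipschitz u := by
  intro x₀ t₀ ht₀
  obtain ⟨K, s, hs, hK⟩ := hu (x := (x₀, t₀)) ⟨trivial, ht₀⟩
  obtain ⟨r, hr, hrs⟩ := Metric.mem_nhdsWithin_iff.1 hs
  have hmem : ∀ x t, 0 < t → dist x x₀ + |t - t₀| < r → (x, t) ∈ s := fun x t ht hxt =>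
    hrs ⟨max_lt ((le_add_of_nonneg_right (abs_nonneg _)).trans_lt hxt)
      ((le_add_of_nonneg_left dist_nonneg).trans_lt hxt), trivial, ht⟩
  refine ⟨r, K + 1, hr, by positivity, fun x y t s ht hs hxt hys => ?_⟩
  calc ‖u x t - u y s‖ = dist (u x t) (u y s) := (dist_eq_norm _ _).symm
    _ ≤ K * dist (x, t) (y, s) := hK.dist_le_mul _ (hmem x t ht hxt) _ (hmem y s hs hys)
    _ ≤ (K + 1) * (dist x y + |t - s|) := by
      gcongr
      · exact le_add_of_nonneg_right zero_le_one
      · exact max_le_add_of_nonneg dist_nonneg (abs_nonneg _)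

end Model

end WeaklyCoupledHJ

open WeaklyCoupledHJ in
theorem theorem1p2_general {E ι : Type*} [NormedAddCommGroup E] [InnerProductSpace ℝ E]
    [ProperSpace E] [Fintype ι] {Λ : AddSubgroup E} [IsClosed (Λ : Set E)] [CompactSpace (E ⧸ Λ)]
    {h : ι → E ⧸ Λ → E → ℝ} {P : ι → E ⧸ Λ → (ι → ℝ) → ℝ} {u : E ⧸ Λ → ℝ → ι → ℝ} {a A : ℝ}
    {I : Set ℝ} (hh : ∀ i, IsQuadraticHamiltonian a A (h i))
    (hP : ∀ i, LocallyLipschitz (Function.uncurry (P i))) (hI : IsOpen I)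
    (hu : IsViscositySolutionOn (fun i x p c => h i x p + P i x c) I u) :
    LocallyLipschitzOn (Set.univ ×ˢ I) (Function.uncurry u) := by
  rintro ⟨x₀, t₀⟩ ⟨-, ht₀⟩
  obtain ⟨ρ, hρ, hball⟩ := Metric.nhds_basis_closedBall.mem_iff.1 (hI.mem_nhds ht₀)
  rw [Real.closedBall_eq_Icc] at hball
  obtain ⟨r, hr, rfl⟩ : ∃ r > 0, ρ = 2 * r := ⟨ρ / 2, by positivity, by ring⟩
  obtain ⟨κ, hκ⟩ := hu.exists_lipschitzWith_space hh hP hball (half_pos hr)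
  obtain ⟨C, hC⟩ := hu.exists_lipschitzOnWith_time (exists_abs_add_le_on_closedBall hh hP)
    ((Set.Icc_subset_Icc (by linarith) (by linarith)).trans hball)
    (show t₀ + r < t₀ + 2 * r - r / 2 by linarith) hκ
  refine ⟨κ + C, Set.univ ×ˢ Set.Icc (t₀ - r) (t₀ + r), mem_nhdsWithin_of_mem_nhds
    (prod_mem_nhds Filter.univ_mem (Icc_mem_nhds (by linarith) (by linarith))),
    lipschitzOnWith_uncurry (fun t ht => (hκ t ?_).lipschitzOnWith) fun x _ => (hC x).mono ?_⟩
  · exact Set.Icc_subset_Icc (by linarith) (by linarith) ht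
  · exact Set.Icc_subset_Icc (by linarith) le_rfl

theorem theorem1p2 {N m : ℕ} (hN : 0 < N) (hm : 0 < m)
    (H : WeaklyCoupledHJ.Hamiltonians N m)
    (hH : WeaklyCoupledHJ.StandingAssumptions H)
    (hA : WeaklyCoupledHJ.ModelStructure H)
    (φ : WeaklyCoupledHJ.Torus N → Fin m → ℝ) (hφ : Continuous φ)
    (u : WeaklyCoupledHJ.Torus N → ℝ → Fin m → ℝ)
    (hu : WeaklyCoupledHJ.IsViscositySolution H φ u) :
    WeaklyCoupledHJ.IsLocallyLipschitz u := by
  obtain ⟨h, P, a, A, hh, hP, rfl⟩ := hH.exists_isQuadraticHamiltonian hA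
  exact WeaklyCoupledHJ.isLocallyLipschitz_of_locallyLipschitzOn
    (theorem1p2_general hh hP isOpen_Ioi hu.isViscositySolutionOn)
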